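/- Let $d,m\ge 1$ and let $B$ be a standard $m$-dimensional Brownian motion on a probability space $(\Omega,\mathcal F,\mathbb P)$. Let $f:\mathbb R^d\to\mathbb R^d$ and $g:\mathbb R^d\to\mathbb R^{d\times m}$ be locally Lipschitz with $f(0)=0$, $g(0)=0$ (coefficients of $dX=f(X)\,dt+g(X)\,dB$), and let $x_0\in\mathbb R^d$. Below $|\cdot|$ is the Euclidean norm on $\mathbb R^d$ and the trace (Frobenius) norm on matrices, and $\log 0=-\infty$. **Lyapunov function.** Let $\delta=1/q$ with an integer $q\ge 4$, and let $V:\mathbb R^d\to[0,\infty)$ be of class $C^4$ with $V(x)\to\infty$ as $|x|\to\infty$, with $V(x)=0$ if and only if $x=0$, with $V(\epsilon x)\le V(x)$ for all $x\in\mathbb R^d$ and $0<\epsilon\le 1$, and such that for some $c>0$ $$|D^{(n)}V(x)|\le c\,(1+V(x))^{1-n\delta}\qquad (x\in\mathbb R^d,\ n=1,2,3,4),$$ where $|D^{(n)}V(x)|$ is the Euclidean norm of the array of all $n$-th order partial derivatives of $V$ at $x$. Let $w:\mathbb R^d\to[0,\infty)$ be continuous and let $\mu>0$, with $$\mathcal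 LV(x):=\langle D^{(1)}V(x),f(x)\rangle+\tfrac12\operatorname{tr}\big[g(x)^TD^{(2)}V(x)g(x)\big]\le -w(x),\qquad w(x)\ge \mu V(x)\qquad (x\in\mathbb R^d).$$ **Scheme.** Put $\Lambda(x)=1\wedge (w(x)/V(x))$ for $x\ne0$. Assume that for every $u>0$ $$\sup_{0<|x|\le u}\frac{(1+V(x))^{1-2\delta}\big(|f(x)|^2\vee|g(x)|^2\big)}{\Lambda(x)V(x)}<\infty ,$$ and let $\varphi:[0,\infty)\to[0,\infty)$ be a continuous strictly increasing function with $\varphi(u)\to\infty$ as $u\to\infty$ and $$\sup_{0<|x|\le u}\left\{\frac{(1+V(x))^{\frac12-\delta}|f(x)|}{(\Lambda(x)V(x))^{1/2}}\vee\frac{(1+V(x))^{1-2\delta}|g(x)|^2}{\Lambda(x)V(x)}\right\}\le\varphi(u)\qquad (u\ge1).$$ Let $0<\theta<\tfrac12$, $K>0$ and $\Delta^*\in(0,1)$ satisfy $K(\Delta^*)^{-\theta}\ge\varphi(|x_0|\vee1)$. For $\Delta\in(0,\Delta^*]$ let $\pi_\Delta(x)=\big(|x|\wedge\varphi^{-1}(K\Delta^{-\theta})\big)\frac{x}{|x|}$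 for $x\neq 0$, $\pi_\Delta(0)=0$, and define $Z_0=x_0$, $$Z_{k+1}=\pi_\Delta\Big(Z_k+f(Z_k)\Delta+g(Z_k)\big(B((k+1)\Delta)-B(k\Delta)\big)\Big),\qquad k\ge0 .$$ **Claim.** For every $\varrho\in(0,\mu)$ there is $\Delta^{**}\in(0,\Delta^*]$ such that for every $\Delta\in(0,\Delta^{**}]$ $$\limsup_{k\to\infty}\frac{\log\big(\mathbb E\,V(Z_k)\big)}{k\Delta}\le-(\mu-\varrho)<0 \qquad\text{and}\qquad \limsup_{k\to\infty}\frac{\log V(Z_k)}{k\Delta}\le-(\mu-\varrho)\quad\text{almost surely.}$$ -/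

import Mathlib

open MeasureTheory ProbabilityTheory Filter Set
open scoped NNReal ENNReal Topology Matrix

noncomputable section

namespace VTruncatedEM

/-- The column space `ℝ^n` with its Euclidean norm. -/
abbrev Vec (n : ℕ) : Type := EuclideanSpace ℝ (Fin n)

/-- The trace (Frobenius) norm `√(tr (AᵀA))` of a real `d × m` matrix. -/
def traceNorm {d m : ℕ} (A : Matrix (Fin d) (Fin m) ℝ) : ℝ :=
  Real.sqrt (∑ i, ∑ j, A i j ^ 2)

/-- Local Lipschitz continuity of a drift `f` and a diffusion coefficient `g`. -/
def LocallyLipschitzCoeffs {d m : ℕ} (f : Vec d → Vec d)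
    (g : Vec d → Matrix (Fin d) (Fin m) ℝ) : Prop :=
  ∀ N : ℝ, 0 < N → ∃ C : ℝ, 0 < C ∧ ∀ x y : Vec d, max ‖x‖ ‖y‖ ≤ N →
    max ‖f x - f y‖ (traceNorm (g x - g y)) ≤ C * ‖x - y‖

/-- The partial derivative `∂ⁿV / ∂x_{j 0} ⋯ ∂x_{j (n-1)}` at `x`. -/
def partialDeriv {d : ℕ} (n : ℕ) (V : Vec d → ℝ) (x : Vec d) (j : Fin n → Fin d) : ℝ :=
  iteratedFDeriv ℝ n V x (fun i => EuclideanSpace.single (j i) (1 : ℝ))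

/-- `|D⁽ⁿ⁾V(x)|`: the Euclidean norm of the family of all `n`-th order partial derivatives,
regarded as a point of `ℝ^(dⁿ)`. For `n = 1` it is the norm of the gradient, for `n = 2` the
trace norm of the Hessian. -/
def derivNorm {d : ℕ} (n : ℕ) (V : Vec d → ℝ) (x : Vec d) : ℝ :=
  Real.sqrt (∑ j : Fin n → Fin d, partialDeriv n V x j ^ 2)

/-- The Hessian matrix `D⁽²⁾V(x)`. -/
def hessian {d : ℕ} (V : Vec d → ℝ) (x : Vec d) : Matrix (Fin d) (Fin d) ℝ :=
  Matrix.of fun i j => partialDeriv 2 V x ![i, j]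

/-- The operator `ℒV(x) = ⟨D⁽¹⁾V(x), f(x)⟩ + ½ tr (g(x)ᵀ D⁽²⁾V(x) g(x))` attached to the equation
`dX = f(X) dt + g(X) dB`. -/
def generator {d m : ℕ} (f : Vec d → Vec d) (g : Vec d → Matrix (Fin d) (Fin m) ℝ)
    (V : Vec d → ℝ) (x : Vec d) : ℝ :=
  ∑ i, partialDeriv 1 V x ![i] * f x i
    + (1 / 2) * Matrix.trace ((g x)ᵀ * hessian V x * g x)

/-- The class of nonnegative `C^p` functions `V` on `ℝ^d` with `V(x) → ∞` as `|x| → ∞`, with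
`|D⁽ⁿ⁾V| ≤ c (1 + V)^(1 - nδ)` for `n = 1, …, p` and some `c > 0`, and with `0` as their only
zero. -/
structure LyapunovClass {d : ℕ} (p : ℕ) (δ : ℝ) (V : Vec d → ℝ) : Prop where
  contDiff : ContDiff ℝ p V
  nonneg : ∀ x, 0 ≤ V x
  tendsto_atTop : Tendsto V (Bornology.cobounded (Vec d)) atTop
  deriv_bound : ∃ c : ℝ, 0 < c ∧ ∀ n : ℕ, 1 ≤ n → n ≤ p → ∀ x,
    derivNorm n V x ≤ c * (1 + V x) ^ (1 - (n : ℝ) * δ)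
  ker_eq : ∀ x, V x = 0 ↔ x = 0

/-- `Λ(x) = 1 ∧ (w(x) / V(x))`; only used at points where `V(x) > 0`. -/
def Lam {d : ℕ} (V w : Vec d → ℝ) (x : Vec d) : ℝ := min 1 (w x / V x)

/-- `φ : [0, ∞) → [0, ∞)` is strictly increasing and continuous, tends to infinity, and for every
`u ≥ 1` it satisfies
`sup_{0 < |x| ≤ u} ( (1+V)^(1/2-δ) |f| / (ΛV)^(1/2) ∨ (1+V)^(1-2δ) |g|² / (ΛV) ) ≤ φ(u)`.
Only the values of `φ` on `[0, ∞)` matter. -/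
structure IsGrowthFunction {d m : ℕ} (δ : ℝ) (f : Vec d → Vec d)
    (g : Vec d → Matrix (Fin d) (Fin m) ℝ) (V w : Vec d → ℝ) (φ : ℝ → ℝ) : Prop where
  nonneg : ∀ u, 0 ≤ u → 0 ≤ φ u
  continuousOn : ContinuousOn φ (Ici 0)
  strictMonoOn : StrictMonoOn φ (Ici 0)
  tendsto_atTop : Tendsto φ atTop atTop
  bound : ∀ u, 1 ≤ u → ∀ x : Vec d, 0 < ‖x‖ → ‖x‖ ≤ u →
    max ((1 + V x) ^ (1 / 2 - δ) * ‖f x‖ / (Lam V w x * V x) ^ (1 / 2 : ℝ))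
        ((1 + V x) ^ (1 - 2 * δ) * traceNorm (g x) ^ 2 / (Lam V w x * V x)) ≤ φ u

/-- The truncation map `x ↦ (|x| ∧ R) x / |x|`, with `0 ↦ 0`. -/
def radialTruncation {d : ℕ} (R : ℝ) (x : Vec d) : Vec d := min ‖x‖ R • (‖x‖⁻¹ • x)

/-- The truncation radius `φ⁻¹(K Δ^(-θ))`, where `φ⁻¹` is the inverse of `φ` on `[0, ∞)`. -/
def truncationRadius (φ : ℝ → ℝ) (K θ Δ : ℝ) : ℝ :=
  Function.invFunOn φ (Ici 0) (K * Δ ^ (-θ))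

/-- One path of the explicit scheme driven by the increments `b 0, b 1, …`:
`Z₀ = x₀` and `Z_{k+1}` is the truncation of `Z_k + f(Z_k) Δ + g(Z_k) b_k` at radius `R`. -/
def scheme {d m : ℕ} (f : Vec d → Vec d) (g : Vec d → Matrix (Fin d) (Fin m) ℝ)
    (R Δ : ℝ) (x₀ : Vec d) (b : ℕ → Vec m) : ℕ → Vec d
  | 0 => x₀
  | k + 1 =>
    let z := scheme f g R Δ x₀ b k
    radialTruncation R (z + Δ • f z + WithLp.toLp 2 (g z *ᵥ WithLp.ofLp (b k)))

variable {Ω : Type*} [MeasurableSpace Ω]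

/-- A standard `m`-dimensional Brownian motion `(B t)_{t ≥ 0}` under `P`. -/
structure IsBrownianMotion {m : ℕ} (B : ℝ≥0 → Ω → Vec m) (P : Measure Ω) : Prop where
  measurable : ∀ t, Measurable (B t)
  zero : ∀ᵐ ω ∂P, B 0 ω = 0
  indepIncrements : HasIndepIncrements B P
  law_sub : ∀ s t : ℝ≥0, s ≤ t →
    HasLaw (fun ω (i : Fin m) => B t ω i - B s ω i)
      (Measure.pi fun _ : Fin m => gaussianReal 0 (t - s)) P
  continuous_paths : ∀ᵐ ω ∂P, Continuous fun t => B t ω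

/-- The increment `ΔB_k = B((k+1)Δ) - B(kΔ)`. -/
def increment {m : ℕ} (B : ℝ≥0 → Ω → Vec m) (Δ : ℝ) (ω : Ω) (k : ℕ) : Vec m :=
  B (Real.toNNReal (((k : ℝ) + 1) * Δ)) ω - B (Real.toNNReal ((k : ℝ) * Δ)) ω

/-- The numerical solution `Z_k` with step size `Δ`. -/
def numSol {d m : ℕ} (f : Vec d → Vec d) (g : Vec d → Matrix (Fin d) (Fin m) ℝ)
    (φ : ℝ → ℝ) (K θ : ℝ) (x₀ : Vec d) (B : ℝ≥0 → Ω → Vec m) (Δ : ℝ) (k : ℕ) (ω : Ω) : Vec d :=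
  scheme f g (truncationRadius φ K θ Δ) Δ x₀ (increment B Δ ω) k

end VTruncatedEM

end

noncomputable section

namespace VTruncatedEM

/-! ### Derivatives along directions -/

/-! The heart is a one-step contraction: on the truncation ball the conditional mean of `V` after
one step is at most `exp (-(μ - ϱ/2) Δ)` times its present value.

Radial truncation shrinks the state by a factor in `(0, 1]`, so it does not increase `V` and the
untruncated step may be estimated instead. It also keeps the path where `φ ≤ K Δ^(-θ)`. Expand `V`
to fourth order about `z`, with drift displacement `F = Δ f(z)` and Gaussian displacement `G`.
Averaging over `G` and `-G` removes the terms odd in `G`. The first-order term in `F` and the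
second-order term in `G` have mean `Δ ℒV(z) ≤ -μ Δ V(z)`. For the rest, displacements are measured
in the unit `S = (1 + V z)^δ`: the `n`-th derivative times `S^n` is at most `c (1 + V z)`, and `(1 +
V)^δ` is globally Lipschitz, which controls the fourth derivative at intermediate points
(`half_add_le`). The growth bounds have `ΛV` in the denominator, so the error is proportional to
`V(z)` and not merely to `1 + V(z)`: it is `C V(z) Δ^(2-2θ)` (`exists_one_step_le`). As `θ < 1/2`,
this is at most `(ϱ/2) Δ V(z)` for small `Δ`.

Independence of `Z_k` from the next increment lets the contraction be iterated
(`lintegral_recursion_le`), so the means decay geometrically. The other half of `ϱ` makes an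
exponentially weighted series of means converge, and Tonelli gives the almost sure rate
(`limsup_log_le_of_lintegral_le`). -/

theorem iteratedFDeriv_apply_eq_sum {d : ℕ} (n : ℕ) (V : Vec d → ℝ) (x : Vec d)
    (v : Fin n → Vec d) :
    iteratedFDeriv ℝ n V x v
      = ∑ j : Fin n → Fin d, (∏ i, v i (j i)) * partialDeriv n V x j := by
  classical
  have hv : ∀ i, v i = ∑ k : Fin d, v i k • EuclideanSpace.single k (1 : ℝ) := by
    intro i
    ext l
    simp [Pi.single_apply]
  conv_lhs => rw [funext hv]
  rw [ContinuousMultilinearMap.map_sum]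
  refine Finset.sum_congr rfl fun j _ => ?_
  rw [ContinuousMultilinearMap.map_smul_univ]
  rfl

/-- Cauchy–Schwarz in `ℝ^(dⁿ)`: the coefficient array of `v 0 ⊗ ⋯ ⊗ v (n-1)` has Euclidean norm `∏
‖v i‖`. -/
theorem abs_iteratedFDeriv_apply_le {d : ℕ} (n : ℕ) (V : Vec d → ℝ) (x : Vec d)
    (v : Fin n → Vec d) :
    |iteratedFDeriv ℝ n V x v| ≤ derivNorm n V x * ∏ i, ‖v i‖ := by
  classical
  have hprod : ∑ j : Fin n → Fin d, (∏ i, v i (j i)) ^ 2 = (∏ i, ‖v i‖) ^ 2 := by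
    simp_rw [← Finset.prod_pow, EuclideanSpace.real_norm_sq_eq]
    rw [Finset.prod_univ_sum]
    simp
  rw [iteratedFDeriv_apply_eq_sum]
  have hCS := Finset.sum_mul_sq_le_sq_mul_sq Finset.univ
    (fun j : Fin n → Fin d => ∏ i, v i (j i)) (fun j => partialDeriv n V x j)
  rw [hprod] at hCS
  refine abs_le_of_sq_le_sq (hCS.trans (le_of_eq ?_)) (by unfold derivNorm; positivity)
  rw [derivNorm, mul_pow, Real.sq_sqrt (by positivity), mul_comm]

theorem iteratedDeriv_comp_line {d : ℕ} {N : ℕ} {V : Vec d → ℝ} (hV : ContDiff ℝ N V) {n : ℕ}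
    (hn : n ≤ N) (x h : Vec d) (s : ℝ) :
    iteratedDeriv n (fun t : ℝ => V (x + t • h)) s
      = iteratedFDeriv ℝ n V (x + s • h) (fun _ => h) := by
  have hW : ContDiff ℝ N (fun y => V (x + y)) := hV.comp (contDiff_const.add contDiff_id)
  have hcomp : (fun t : ℝ => V (x + t • h))
      = (fun y => V (x + y)) ∘ (ContinuousLinearMap.toSpanSingleton ℝ h) := by
    ext t; simp
  rw [iteratedDeriv_eq_iteratedFDeriv, hcomp,
    ContinuousLinearMap.iteratedFDeriv_comp_right _ hW _ (by exact_mod_cast hn),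
    ContinuousMultilinearMap.compContinuousLinearMap_apply, iteratedFDeriv_comp_add_left]
  simp

/-- The one-variable Lagrange remainder formula for `t ↦ V (x + t • h)` on `[0, 1]`. -/
theorem exists_taylor_four {d : ℕ} {V : Vec d → ℝ} (hV : ContDiff ℝ 4 V) (x h : Vec d) :
    ∃ s ∈ Ioo (0 : ℝ) 1, V (x + h) = V x + iteratedFDeriv ℝ 1 V x (fun _ => h)
      + iteratedFDeriv ℝ 2 V x (fun _ => h) / 2 + iteratedFDeriv ℝ 3 V x (fun _ => h) / 6
      + iteratedFDeriv ℝ 4 V (x + s • h) (fun _ => h) / 24 := by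
  set p : ℝ → ℝ := fun t => V (x + t • h) with hp
  have hpC : ContDiff ℝ 4 p := hV.comp (by fun_prop)
  have key := taylor_mean_remainder_lagrange_iteratedDeriv (f := p) (x := 1) (x₀ := 0) (n := 3)
    (by norm_num) (hpC.contDiffOn.of_le (by norm_num))
  obtain ⟨s, hs, hse⟩ := key
  have hd : ∀ n ≤ 4, ∀ s, iteratedDeriv n p s = iteratedFDeriv ℝ n V (x + s • h) (fun _ => h) :=
    fun n hn s => iteratedDeriv_comp_line (N := 4) hV hn x h s
  have hdw : ∀ n ≤ 4, iteratedDerivWithin n p (Set.uIcc 0 1) 0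
      = iteratedFDeriv ℝ n V x (fun _ => h) := by
    intro n hn
    rw [iteratedDerivWithin_eq_iteratedDeriv (uniqueDiffOn_uIcc (by norm_num))
      (hpC.contDiffAt.of_le (by exact_mod_cast hn)) (by simp), hd n hn]
    simp
  rw [uIoo_of_le zero_le_one] at hs
  refine ⟨s, hs, ?_⟩
  rw [taylor_within_apply] at hse
  simp only [Finset.sum_range_succ, Finset.sum_range_zero] at hse
  rw [hdw 0 (by norm_num), hdw 1 (by norm_num), hdw 2 (by norm_num), hdw 3 (by norm_num),
    hd _ (by norm_num)] at hse
  simp only [hp, Nat.factorial, iteratedFDeriv_zero_apply] at hse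
  norm_num at hse
  rw [iteratedFDeriv_one_apply]
  linarith

theorem multilinear_two_diag_add_sub {d : ℕ} (T : (Vec d) [×2]→L[ℝ] ℝ) (F G : Vec d) :
    T (fun _ => F + G) + T (fun _ => F - G) = 2 * (T (fun _ => F) + T (fun _ => G)) := by
  have e : ∀ a : Vec d, (fun _ : Fin 2 => a) = ![a, a] := by
    intro a; ext i; fin_cases i <;> rfl
  have a0 : ∀ a a' b, T ![a + a', b] = T ![a, b] + T ![a', b] := fun a a' b =>
    T.toMultilinearMap.cons_add ![b] a a'
  have a1 : ∀ a b b', T ![a, b + b'] = T ![a, b] + T ![a, b'] := by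
    intro a b b'
    have h := T.map_update_add ![a, b] 1 b b'
    have u : ∀ y, Function.update ![a, b] 1 y = ![a, y] := by
      intro y; ext i; fin_cases i <;> simp
    simpa only [u] using h
  have n0 : ∀ a b, T ![-a, b] = - T ![a, b] := by
    intro a b
    have h := a0 a (-a) b
    have h0 : T ![0, b] = 0 := T.map_coord_zero 0 (by simp)
    rw [add_neg_cancel, h0] at h; linarith
  have n1 : ∀ a b, T ![a, -b] = - T ![a, b] := by
    intro a b
    have h := a1 a b (-b)
    have h0 : T ![a, 0] = 0 := T.map_coord_zero 1 (by simp)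
    rw [add_neg_cancel, h0] at h; linarith
  simp only [e, sub_eq_add_neg, a0, a1, n0, n1]
  ring

/-- Terms with an odd number of `G`s cancel. Symmetry of `T` is not needed: the three placements of
`F` are kept apart and later get the same bound. -/
theorem multilinear_three_diag_add_sub {d : ℕ} (T : (Vec d) [×3]→L[ℝ] ℝ) (F G : Vec d) :
    T (fun _ => F + G) + T (fun _ => F - G)
      = 2 * (T (fun _ => F) + T ![F, G, G] + T ![G, F, G] + T ![G, G, F]) := by
  have e : ∀ a : Vec d, (fun _ : Fin 3 => a) = ![a, a, a] := by
    intro a; ext i; fin_cases i <;> rfl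
  have a0 : ∀ a a' b c, T ![a + a', b, c] = T ![a, b, c] + T ![a', b, c] := fun a a' b c =>
    T.toMultilinearMap.cons_add ![b, c] a a'
  have a1 : ∀ a b b' c, T ![a, b + b', c] = T ![a, b, c] + T ![a, b', c] := by
    intro a b b' c
    have h := T.map_update_add ![a, b, c] 1 b b'
    have u : ∀ y, Function.update ![a, b, c] 1 y = ![a, y, c] := by
      intro y; ext i; fin_cases i <;> simp
    simpa only [u] using h
  have a2 : ∀ a b c c', T ![a, b, c + c'] = T ![a, b, c] + T ![a, b, c'] := by
    intro a b c c'
    have h := T.map_update_add ![a, b, c] 2 c c'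
    have u : ∀ y, Function.update ![a, b, c] 2 y = ![a, b, y] := by
      intro y; ext i; fin_cases i <;> simp
    simpa only [u] using h
  have n0 : ∀ a b c, T ![-a, b, c] = - T ![a, b, c] := by
    intro a b c
    have h := a0 a (-a) b c
    have h0 : T ![0, b, c] = 0 := T.map_coord_zero 0 (by simp)
    rw [add_neg_cancel, h0] at h; linarith
  have n1 : ∀ a b c, T ![a, -b, c] = - T ![a, b, c] := by
    intro a b c
    have h := a1 a b (-b) c
    have h0 : T ![a, 0, c] = 0 := T.map_coord_zero 1 (by simp)
    rw [add_neg_cancel, h0] at h; linarith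
  have n2 : ∀ a b c, T ![a, b, -c] = - T ![a, b, c] := by
    intro a b c
    have h := a2 a b c (-c)
    have h0 : T ![a, b, 0] = 0 := T.map_coord_zero 2 (by simp)
    rw [add_neg_cancel, h0] at h; linarith
  simp only [e, sub_eq_add_neg, a0, a1, a2, n0, n1, n2]
  ring

/-! ### Growth of Lyapunov functions -/

/-- The gradient of `(1 + V)^δ` is `δ (1 + V)^(δ-1) ∇V`, and the bound on `∇V` cancels the power
exactly, leaving the global Lipschitz constant `c δ`. -/
theorem LyapunovClass.rpow_le {d p : ℕ} {δ : ℝ} {V : Vec d → ℝ} (hV : LyapunovClass p δ V)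
    (hp : 1 ≤ p) (hδ : 0 < δ) {c : ℝ}
    (hc : ∀ x, derivNorm 1 V x ≤ c * (1 + V x) ^ (1 - δ)) (x v : Vec d) :
    (1 + V (x + v)) ^ δ ≤ (1 + V x) ^ δ + c * δ * ‖v‖ := by
  have hpos : ∀ y, 0 < 1 + V y := fun y => by have := hV.nonneg y; linarith
  have hdiff : Differentiable ℝ V :=
    hV.contDiff.differentiable (by exact_mod_cast (by lia : p ≠ 0))
  have hfd : ∀ y, ‖fderiv ℝ V y‖ ≤ c * (1 + V y) ^ (1 - δ) := by
    intro y
    refine (ContinuousLinearMap.opNorm_le_bound _ (by unfold derivNorm; positivity)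
      fun u => ?_).trans (hc y)
    have := abs_iteratedFDeriv_apply_le 1 V y (fun _ => u)
    simpa [iteratedFDeriv_one_apply] using this
  have hU : ∀ y, HasFDerivAt (fun y => (1 + V y) ^ δ)
      ((δ * (1 + V y) ^ (δ - 1)) • fderiv ℝ V y) y := fun y =>
    ((hdiff y).hasFDerivAt.const_add 1).rpow_const (Or.inl (hpos y).ne')
  have hb : ∀ y, ‖(δ * (1 + V y) ^ (δ - 1)) • fderiv ℝ V y‖ ≤ c * δ := by
    intro y
    have h1 : 0 < (1 + V y) ^ (δ - 1) := Real.rpow_pos_of_pos (hpos y) _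
    rw [norm_smul, Real.norm_of_nonneg (by positivity)]
    calc δ * (1 + V y) ^ (δ - 1) * ‖fderiv ℝ V y‖
        ≤ δ * (1 + V y) ^ (δ - 1) * (c * (1 + V y) ^ (1 - δ)) := by gcongr; exact hfd y
      _ = c * δ * ((1 + V y) ^ (δ - 1) * (1 + V y) ^ (1 - δ)) := by ring
      _ = c * δ := by rw [← Real.rpow_add (hpos y)]; simp
  have := convex_univ.norm_image_sub_le_of_norm_hasFDerivWithin_le
    (fun y _ => (hU y).hasFDerivWithinAt) (fun y _ => hb y) (mem_univ x) (mem_univ (x + v))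
  rw [add_sub_cancel_left] at this
  linarith [le_of_abs_le this]

/-- A fourth-order expansion of `V` along `z + F ± G`, in the scale `S = (1 + V z)^δ` in which the
derivatives of `V` are controlled. -/
theorem LyapunovClass.half_add_le {d q : ℕ} (hq : 4 ≤ q) {δ : ℝ} (hδ : δ = 1 / (q : ℝ))
    {V : Vec d → ℝ} (hV : LyapunovClass 4 δ V) {c : ℝ} (hc0 : 0 < c)
    (hc : ∀ n : ℕ, 1 ≤ n → n ≤ 4 → ∀ x, derivNorm n V x ≤ c * (1 + V x) ^ (1 - (n : ℝ) * δ))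
    (z F G : Vec d) {α r t : ℝ} (ht : 0 ≤ t) (hα0 : 0 ≤ α) (hαr : α ≤ r)
    (hF : ‖F‖ ≤ (1 + V z) ^ δ * α) (hG : ‖G‖ ≤ (1 + V z) ^ δ * (r * t)) :
    (V (z + (F + G)) + V (z + (F - G))) / 2 ≤
      V z + iteratedFDeriv ℝ 1 V z (fun _ => F) + iteratedFDeriv ℝ 2 V z (fun _ => G) / 2
        + c * (1 + V z) * (α ^ 2 / 2 + α * r ^ 2 * (1 + 3 * t ^ 2) / 6
          + r ^ 4 * (1 + t) ^ 4 * (1 + c * δ * (r * (1 + t))) ^ (q - 4) / 24) := by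
  have hr0 : 0 ≤ r := hα0.trans hαr
  have hq0 : (0 : ℝ) < q := by exact_mod_cast (by lia : 0 < q)
  have hδ0 : 0 < δ := by rw [hδ]; positivity
  have hpos : ∀ y, 0 < 1 + V y := fun y => by have := hV.nonneg y; linarith
  set S : ℝ := (1 + V z) ^ δ with hS
  have hS0 : 0 < S := Real.rpow_pos_of_pos (hpos z) _
  -- Each unit `S` of displacement pays for one loss of `δ` in the exponent of the derivative bound.
  have hSn : ∀ n : ℕ, (1 + V z) ^ (1 - (n : ℝ) * δ) * S ^ n = 1 + V z := by
    intro n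
    rw [hS, ← Real.rpow_natCast, ← Real.rpow_mul (hpos z).le, ← Real.rpow_add (hpos z)]
    rw [show 1 - (n : ℝ) * δ + δ * n = 1 by ring, Real.rpow_one]
  have hSq : S ^ q = 1 + V z := by
    rw [hS, ← Real.rpow_natCast, ← Real.rpow_mul (hpos z).le, hδ]
    rw [one_div_mul_cancel hq0.ne', Real.rpow_one]
  have hderiv : ∀ n : ℕ, 1 ≤ n → n ≤ 4 → ∀ v : Fin n → Vec d, ∀ β : Fin n → ℝ,
      (∀ i, ‖v i‖ ≤ S * β i) →
      |iteratedFDeriv ℝ n V z v| ≤ c * (1 + V z) * ∏ i, β i := by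
    intro n h1 h4 v β hv
    calc |iteratedFDeriv ℝ n V z v| ≤ derivNorm n V z * ∏ i, ‖v i‖ :=
          abs_iteratedFDeriv_apply_le n V z v
      _ ≤ (c * (1 + V z) ^ (1 - (n : ℝ) * δ)) * ∏ i, (S * β i) := by
          gcongr with i
          · exact mul_nonneg hc0.le (Real.rpow_nonneg (hpos z).le _)
          · exact hc n h1 h4 z
          · exact hv i
      _ = c * ((1 + V z) ^ (1 - (n : ℝ) * δ) * S ^ n) * ∏ i, β i := by
          rw [Finset.prod_mul_distrib]; simp; ring
      _ = _ := by rw [hSn]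
  have hrem : ∀ h : Vec d, ‖h‖ ≤ S * (r * (1 + t)) → ∀ s ∈ Ioo (0 : ℝ) 1,
      iteratedFDeriv ℝ 4 V (z + s • h) (fun _ => h)
        ≤ c * (1 + V z) * (r ^ 4 * (1 + t) ^ 4 * (1 + c * δ * (r * (1 + t))) ^ (q - 4)) := by
    intro h hh s hs
    have h1 := (le_abs_self _).trans
      (abs_iteratedFDeriv_apply_le 4 V (z + s • h) (fun _ => h))
    have h2 : (1 + V (z + s • h)) ^ δ ≤ S * (1 + c * δ * (r * (1 + t))) := by
      refine (hV.rpow_le (by norm_num) hδ0 (c := c)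
        (by simpa using hc 1 le_rfl (by norm_num)) z (s • h)).trans ?_
      have h3 : ‖s • h‖ ≤ S * (r * (1 + t)) := by
        rw [norm_smul, Real.norm_of_nonneg hs.1.le]
        exact (mul_le_of_le_one_left (norm_nonneg _) hs.2.le).trans hh
      have h4 : c * δ * ‖s • h‖ ≤ c * δ * (S * (r * (1 + t))) := by gcongr
      linarith
    -- With `δ = 1/q` and `q ≥ 4` the exponent `1 - 4δ = δ (q - 4)` is nonnegative, so the Lipschitz
    -- bound `h2` can be raised to the natural power `q - 4`.
    have h5 : (1 + V (z + s • h)) ^ (1 - ((4 : ℕ) : ℝ) * δ)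
        = ((1 + V (z + s • h)) ^ δ) ^ (q - 4) := by
      rw [← Real.rpow_natCast, ← Real.rpow_mul (hpos _).le]
      congr 1
      rw [Nat.cast_sub hq, hδ]
      field_simp
    have h6 : S ^ (q - 4) * S ^ 4 = 1 + V z := by rw [← pow_add, Nat.sub_add_cancel hq, hSq]
    have h7 : 0 ≤ (1 + V (z + s • h)) ^ δ := Real.rpow_nonneg (hpos _).le _
    calc iteratedFDeriv ℝ 4 V (z + s • h) (fun _ => h)
        ≤ derivNorm 4 V (z + s • h) * ∏ _i : Fin 4, ‖h‖ := h1
      _ = derivNorm 4 V (z + s • h) * ‖h‖ ^ 4 := by simp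
      _ ≤ (c * (S * (1 + c * δ * (r * (1 + t)))) ^ (q - 4)) * (S * (r * (1 + t))) ^ 4 := by
          gcongr
          refine (hc 4 (by norm_num) le_rfl _).trans ?_
          rw [h5]
          gcongr
      _ = c * (S ^ (q - 4) * S ^ 4)
            * (r ^ 4 * (1 + t) ^ 4 * (1 + c * δ * (r * (1 + t))) ^ (q - 4)) := by
          rw [mul_pow, mul_pow, mul_pow]; ring
      _ = _ := by rw [h6]
  have hFG : ‖F‖ + ‖G‖ ≤ S * (r * (1 + t)) := by
    have : S * α ≤ S * r := by gcongr
    linarith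
  obtain ⟨s₁, hs₁, e₁⟩ := exists_taylor_four hV.contDiff z (F + G)
  obtain ⟨s₂, hs₂, e₂⟩ := exists_taylor_four hV.contDiff z (F - G)
  have b₁ := hrem (F + G) ((norm_add_le _ _).trans hFG) s₁ hs₁
  have b₂ := hrem (F - G) ((norm_sub_le _ _).trans hFG) s₂ hs₂
  have lin : iteratedFDeriv ℝ 1 V z (fun _ => F + G) + iteratedFDeriv ℝ 1 V z (fun _ => F - G)
      = 2 * iteratedFDeriv ℝ 1 V z (fun _ => F) := by
    simp only [iteratedFDeriv_one_apply, map_add, map_sub]; ring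
  have quad := multilinear_two_diag_add_sub (iteratedFDeriv ℝ 2 V z) F G
  have cub := multilinear_three_diag_add_sub (iteratedFDeriv ℝ 3 V z) F G
  have q1 := (le_abs_self _).trans
    (hderiv 2 (by norm_num) (by norm_num) (fun _ => F) (fun _ => α) (fun _ => hF))
  have c1 := (le_abs_self _).trans
    (hderiv 3 (by norm_num) (by norm_num) (fun _ => F) (fun _ => α) (fun _ => hF))
  have c2 := (le_abs_self _).trans
    (hderiv 3 (by norm_num) (by norm_num) ![F, G, G] ![α, r * t, r * t]
      (by intro i; fin_cases i <;> simp [hF, hG]))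
  have c3 := (le_abs_self _).trans
    (hderiv 3 (by norm_num) (by norm_num) ![G, F, G] ![r * t, α, r * t]
      (by intro i; fin_cases i <;> simp [hF, hG]))
  have c4 := (le_abs_self _).trans
    (hderiv 3 (by norm_num) (by norm_num) ![G, G, F] ![r * t, r * t, α]
      (by intro i; fin_cases i <;> simp [hF, hG]))
  simp [Fin.prod_univ_succ] at q1 c1 c2 c3 c4
  -- The pure cubic drift term is absorbed into the scale `α r²` of the mixed ones.
  have hα3 : c * (1 + V z) * α ^ 3 ≤ c * (1 + V z) * (α * r ^ 2) := by
    have := hpos z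
    have h3 : α ^ 3 ≤ α * r ^ 2 := by
      rw [pow_succ']
      gcongr
    gcongr
  rw [e₁, e₂]
  generalize r ^ 4 * (1 + t) ^ 4 * (1 + c * δ * (r * (1 + t))) ^ (q - 4) = X at *
  generalize c * (1 + V z) = M at *
  have q1' : iteratedFDeriv ℝ 2 V z (fun _ => F) ≤ M * α ^ 2 := q1.trans_eq (by ring)
  have c1' : iteratedFDeriv ℝ 3 V z (fun _ => F) ≤ M * (α * r ^ 2) := c1.trans hα3
  have c2' : iteratedFDeriv ℝ 3 V z ![F, G, G] ≤ M * (α * r ^ 2 * t ^ 2) :=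
    c2.trans_eq (by ring)
  have c3' : iteratedFDeriv ℝ 3 V z ![G, F, G] ≤ M * (α * r ^ 2 * t ^ 2) :=
    c3.trans_eq (by ring)
  have c4' : iteratedFDeriv ℝ 3 V z ![G, G, F] ≤ M * (α * r ^ 2 * t ^ 2) :=
    c4.trans_eq (by ring)
  have split : M * (α ^ 2 / 2 + α * r ^ 2 * (1 + 3 * t ^ 2) / 6 + X / 24)
      = M * α ^ 2 / 2 + (M * (α * r ^ 2) + 3 * (M * (α * r ^ 2 * t ^ 2))) / 6 + M * X / 24 := by
    ring
  rw [split]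
  linarith

/-! ### Moments of the standard Gaussian -/

theorem integrable_one_add_norm_pow {m : ℕ} (n : ℕ) :
    Integrable (fun x : Vec m => (1 + ‖x‖) ^ n) (stdGaussian (Vec m)) := by
  have h0 : MemLp (fun x : Vec m => ‖x‖) (n : ℝ≥0∞) (stdGaussian (Vec m)) :=
    (IsGaussian.memLp_id (stdGaussian (Vec m)) (n : ℝ≥0∞) (ENNReal.natCast_ne_top n)).norm
  have h1 : MemLp ((fun _ : Vec m => (1 : ℝ)) + fun x : Vec m => ‖x‖) (n : ℝ≥0∞)
      (stdGaussian (Vec m)) := (memLp_const (1 : ℝ)).add h0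
  have h2 := h1.integrable_norm_pow'
  have h3 : ∀ x : Vec m, ‖1 + ‖x‖‖ = 1 + ‖x‖ := fun x => Real.norm_of_nonneg (by positivity)
  simpa only [Pi.add_apply, h3] using h2

theorem integral_mul_stdGaussian {m : ℕ} (k l : Fin m) :
    ∫ x : Vec m, x k * x l ∂(stdGaussian (Vec m)) = if k = l then 1 else 0 := by
  have h := covarianceBilin_apply_eq_cov (μ := stdGaussian (Vec m)) IsGaussian.memLp_two_id
    (EuclideanSpace.single k (1 : ℝ)) (EuclideanSpace.single l (1 : ℝ))
  rw [covarianceBilin_stdGaussian, covariance] at h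
  have e : ∀ i : Fin m, (fun x : Vec m => inner ℝ (EuclideanSpace.single i (1 : ℝ)) x)
      = fun x => x i := by
    intro i; ext x; simp [EuclideanSpace.inner_single_left]
  have z : ∀ i : Fin m, ∫ x : Vec m, x i ∂(stdGaussian (Vec m)) = 0 := fun i =>
    integral_strongDual_stdGaussian (EuclideanSpace.proj (𝕜 := ℝ) i)
  simp only [e, z, sub_zero] at h
  rw [← h, innerSL_apply_apply, EuclideanSpace.inner_single_left]
  simp

theorem integrable_mul_stdGaussian {m : ℕ} (k l : Fin m) :
    Integrable (fun x : Vec m => x k * x l) (stdGaussian (Vec m)) := by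
  refine (integrable_one_add_norm_pow 2).mono' (by fun_prop) (ae_of_all _ fun x => ?_)
  rw [norm_mul]
  have h1 := PiLp.norm_apply_le x k
  have h2 := PiLp.norm_apply_le x l
  nlinarith [norm_nonneg (x k), norm_nonneg (x l), norm_nonneg x]

theorem map_neg_stdGaussian {m : ℕ} :
    (stdGaussian (Vec m)).map (fun x => -x) = stdGaussian (Vec m) :=
  stdGaussian_map (LinearIsometryEquiv.neg ℝ (E := Vec m))

/-! ### The diffusion term -/

/-- The Euclidean vector `A x`. -/
def mulVecE {d m : ℕ} (A : Matrix (Fin d) (Fin m) ℝ) (x : Vec m) : Vec d :=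
  WithLp.toLp 2 (A *ᵥ WithLp.ofLp x)

theorem norm_mulVecE_le {d m : ℕ} (A : Matrix (Fin d) (Fin m) ℝ) (x : Vec m) :
    ‖mulVecE A x‖ ≤ traceNorm A * ‖x‖ := by
  refine (pow_le_pow_iff_left₀ (norm_nonneg _) (by unfold traceNorm; positivity)
    two_ne_zero).1 ?_
  rw [EuclideanSpace.real_norm_sq_eq, mul_pow, traceNorm, Real.sq_sqrt (by positivity),
    Finset.sum_mul]
  refine Finset.sum_le_sum fun i _ => ?_
  rw [EuclideanSpace.real_norm_sq_eq]
  exact Finset.sum_mul_sq_le_sq_mul_sq Finset.univ (A i) x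

theorem mulVecE_smul {d m : ℕ} (A : Matrix (Fin d) (Fin m) ℝ) (c : ℝ) (x : Vec m) :
    mulVecE A (c • x) = c • mulVecE A x := by
  simp [mulVecE, Matrix.mulVec_smul]

theorem mulVecE_neg {d m : ℕ} (A : Matrix (Fin d) (Fin m) ℝ) (x : Vec m) :
    mulVecE A (-x) = - mulVecE A x := by
  simp [mulVecE, Matrix.mulVec_neg]

theorem measurable_mulVecE {d m : ℕ} (A : Matrix (Fin d) (Fin m) ℝ) :
    Measurable (mulVecE A) := by
  unfold mulVecE
  refine Continuous.measurable ?_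
  fun_prop

theorem iteratedFDeriv_two_mulVecE {d m : ℕ} (V : Vec d → ℝ) (z : Vec d)
    (A : Matrix (Fin d) (Fin m) ℝ) (x : Vec m) :
    iteratedFDeriv ℝ 2 V z (fun _ => mulVecE A x)
      = ∑ k, ∑ l, (x k * x l) * ∑ i, ∑ j, A i k * hessian V z i j * A j l := by
  rw [iteratedFDeriv_apply_eq_sum, ← (finTwoArrowEquiv (Fin d)).symm.sum_comp,
    Fintype.sum_prod_type]
  have h : ∀ i j, (∏ s, (mulVecE A x) ((finTwoArrowEquiv (Fin d)).symm (i, j) s))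
      * partialDeriv 2 V z ((finTwoArrowEquiv (Fin d)).symm (i, j))
      = ∑ k, ∑ l, (x k * x l) * (A i k * hessian V z i j * A j l) := by
    intro i j
    have e : (finTwoArrowEquiv (Fin d)).symm (i, j) = ![i, j] := rfl
    rw [e, Fin.prod_univ_two]
    simp only [mulVecE, Matrix.mulVec, dotProduct, hessian, Matrix.of_apply, Matrix.cons_val_zero,
      Matrix.cons_val_one]
    rw [Finset.sum_mul_sum, Finset.sum_mul]
    refine Finset.sum_congr rfl fun k _ => ?_
    rw [Finset.sum_mul]
    exact Finset.sum_congr rfl fun l _ => by ring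
  simp only [h, Finset.mul_sum]
  calc _ = ∑ i, ∑ k, ∑ j, ∑ l, x k * x l * (A i k * hessian V z i j * A j l) :=
        Finset.sum_congr rfl fun i _ => Finset.sum_comm
    _ = ∑ k, ∑ i, ∑ j, ∑ l, x k * x l * (A i k * hessian V z i j * A j l) := Finset.sum_comm
    _ = ∑ k, ∑ i, ∑ l, ∑ j, x k * x l * (A i k * hessian V z i j * A j l) :=
        Finset.sum_congr rfl fun k _ => Finset.sum_congr rfl fun i _ => Finset.sum_comm
    _ = _ := Finset.sum_congr rfl fun k _ => Finset.sum_comm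

/-- The standard Gaussian has identity covariance, so only the diagonal `k = l` survives, and it
sums to the trace in the generator. -/
theorem integral_hessian_mulVecE {d m : ℕ} (V : Vec d → ℝ) (z : Vec d)
    (A : Matrix (Fin d) (Fin m) ℝ) :
    Integrable (fun x : Vec m => iteratedFDeriv ℝ 2 V z (fun _ => mulVecE A x))
        (stdGaussian (Vec m)) ∧
      ∫ x : Vec m, iteratedFDeriv ℝ 2 V z (fun _ => mulVecE A x) ∂(stdGaussian (Vec m))
        = Matrix.trace (Aᵀ * hessian V z * A) := by
  simp_rw [iteratedFDeriv_two_mulVecE]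
  have hi : ∀ k l, Integrable (fun x : Vec m =>
      (x k * x l) * ∑ i, ∑ j, A i k * hessian V z i j * A j l) (stdGaussian (Vec m)) :=
    fun k l => (integrable_mul_stdGaussian k l).mul_const _
  refine ⟨integrable_finsetSum _ fun k _ => integrable_finsetSum _ fun l _ => hi k l, ?_⟩
  rw [integral_finsetSum _ fun k _ => integrable_finsetSum _ fun l _ => hi k l]
  simp_rw [integral_finsetSum _ fun l _ => hi _ l, integral_mul_const,
    integral_mul_stdGaussian]
  simp only [ite_mul, one_mul, zero_mul, Finset.sum_ite_eq, Finset.mem_univ, if_true,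
    Matrix.trace, Matrix.diag, Matrix.mul_apply, Matrix.transpose_apply, Finset.sum_mul]
  exact Finset.sum_congr rfl fun k _ => Finset.sum_comm

theorem sum_partialDeriv_one_mul {d : ℕ} (V : Vec d → ℝ) (z v : Vec d) :
    ∑ i, partialDeriv 1 V z ![i] * v i = iteratedFDeriv ℝ 1 V z (fun _ => v) := by
  have hv : v = ∑ k : Fin d, v k • EuclideanSpace.single k (1 : ℝ) := by
    ext l
    simp [Pi.single_apply]
  simp only [partialDeriv, iteratedFDeriv_one_apply]
  conv_rhs => rw [hv, map_sum]
  refine Finset.sum_congr rfl fun i _ => ?_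
  simp [mul_comm]

/-! ### The one-step estimate -/

/-- Used with `W = 1 + V z`, `v = V z`, `ε = Δ^(1-θ)`. Pairing `W` with `α²` or `r²` trades it for
`v`; the remaining factors `α ≤ K ε` and `r² ≤ κ² ε` bring every term to order `ε²`. Since `4 + (q -
4) = q`, the growth in `t` fits under `(1 + t)^q`. -/
theorem remainder_le {q : ℕ} (hq : 4 ≤ q) {W v α r t ε K κ b : ℝ} (hW : v ≤ W) (hW0 : 0 < W)
    (hv : 0 ≤ v) (hα : 0 ≤ α) (hr : 0 ≤ r) (ht : 0 ≤ t) (hε0 : 0 < ε) (hε1 : ε ≤ 1) (hK : 0 < K)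
    (hκ : 0 ≤ κ) (hb : 0 ≤ b) (h1 : W * α ^ 2 ≤ v * (K * ε) ^ 2)
    (h2 : W * r ^ 2 ≤ v * (κ ^ 2 * ε)) :
    W * (α ^ 2 / 2 + α * r ^ 2 * (1 + 3 * t ^ 2) / 6
          + r ^ 4 * (1 + t) ^ 4 * (1 + b * (r * (1 + t))) ^ (q - 4) / 24)
      ≤ (K ^ 2 + K * κ ^ 2 + κ ^ 4 * (1 + b * κ) ^ (q - 4)) * (v * ε ^ 2) * (1 + t) ^ q := by
  have hα' : α ≤ K * ε := by
    refine (pow_le_pow_iff_left₀ hα (by positivity) two_ne_zero).1 ?_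
    refine le_of_mul_le_mul_left (h1.trans ?_) hW0
    gcongr
  have hr2 : r ^ 2 ≤ κ ^ 2 * ε := by
    refine le_of_mul_le_mul_left (h2.trans ?_) hW0
    gcongr
  -- The cruder bound on `r`, from `ε ≤ 1`, serves only inside the power `q - 4`, where no smallness
  -- is needed.
  have hr' : r ≤ κ := by
    refine (pow_le_pow_iff_left₀ hr hκ two_ne_zero).1 (hr2.trans ?_)
    exact mul_le_of_le_one_right (by positivity) hε1
  have ht1 : 1 ≤ (1 + t) ^ q := one_le_pow₀ (by linarith)
  have ht2 : (1 + 3 * t ^ 2) / 6 ≤ (1 + t) ^ q := by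
    have : (1 + t) ^ 2 ≤ (1 + t) ^ q := pow_le_pow_right₀ (by linarith) (by lia)
    nlinarith
  have a1 : W * α ^ 2 / 2 ≤ K ^ 2 * (v * ε ^ 2) * (1 + t) ^ q := by
    have h0 : 0 ≤ W * α ^ 2 := by positivity
    calc W * α ^ 2 / 2 ≤ v * (K * ε) ^ 2 := by linarith
      _ = K ^ 2 * (v * ε ^ 2) * 1 := by ring
      _ ≤ _ := by gcongr
  have a2 : W * r ^ 2 * (α * ((1 + 3 * t ^ 2) / 6))
      ≤ K * κ ^ 2 * (v * ε ^ 2) * (1 + t) ^ q := by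
    calc W * r ^ 2 * (α * ((1 + 3 * t ^ 2) / 6))
        ≤ v * (κ ^ 2 * ε) * ((K * ε) * (1 + t) ^ q) := by gcongr
      _ = _ := by ring
  have a3 : W * r ^ 2 * (r ^ 2 * ((1 + t) ^ 4 * (1 + b * (r * (1 + t))) ^ (q - 4)))
      ≤ κ ^ 4 * (1 + b * κ) ^ (q - 4) * (v * ε ^ 2) * (1 + t) ^ q := by
    have e : 1 + b * (r * (1 + t)) ≤ (1 + b * κ) * (1 + t) := by
      have : b * (r * (1 + t)) ≤ b * (κ * (1 + t)) := by gcongr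
      nlinarith
    calc W * r ^ 2 * (r ^ 2 * ((1 + t) ^ 4 * (1 + b * (r * (1 + t))) ^ (q - 4)))
        ≤ v * (κ ^ 2 * ε) * ((κ ^ 2 * ε)
            * ((1 + t) ^ 4 * ((1 + b * κ) * (1 + t)) ^ (q - 4))) := by gcongr
      _ = κ ^ 4 * (1 + b * κ) ^ (q - 4) * (v * ε ^ 2) * ((1 + t) ^ 4 * (1 + t) ^ (q - 4)) := by
          rw [mul_pow]; ring
      _ = _ := by rw [← pow_add, Nat.add_sub_cancel' hq]
  have a3' : W * (r ^ 4 * (1 + t) ^ 4 * (1 + b * (r * (1 + t))) ^ (q - 4) / 24)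
      ≤ W * r ^ 2 * (r ^ 2 * ((1 + t) ^ 4 * (1 + b * (r * (1 + t))) ^ (q - 4))) := by
    have h0 : 0 ≤ W * r ^ 2 * (r ^ 2 * ((1 + t) ^ 4 * (1 + b * (r * (1 + t))) ^ (q - 4))) := by
      positivity
    calc _ = W * r ^ 2 * (r ^ 2 * ((1 + t) ^ 4 * (1 + b * (r * (1 + t))) ^ (q - 4))) / 24 := by
          ring
      _ ≤ _ := by linarith
  calc _ = W * α ^ 2 / 2 + W * r ^ 2 * (α * ((1 + 3 * t ^ 2) / 6))
        + W * (r ^ 4 * (1 + t) ^ 4 * (1 + b * (r * (1 + t))) ^ (q - 4) / 24) := by ring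
    _ ≤ _ := by linarith

/-- The Gaussian law is invariant under `x ↦ -x`. With lower integrals, integrability of `U` need
not be known beforehand. -/
theorem lintegral_stdGaussian_symm {m : ℕ} {U : Vec m → ℝ} (hU : Measurable U)
    (h0 : ∀ x, 0 ≤ U x) :
    ∫⁻ x, ENNReal.ofReal (U x) ∂(stdGaussian (Vec m))
      = ∫⁻ x, ENNReal.ofReal ((U x + U (-x)) / 2) ∂(stdGaussian (Vec m)) := by
  have hn : ∫⁻ x, ENNReal.ofReal (U (-x) / 2) ∂(stdGaussian (Vec m))
      = ∫⁻ x, ENNReal.ofReal (U x / 2) ∂(stdGaussian (Vec m)) := by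
    conv_rhs => rw [← map_neg_stdGaussian]
    rw [lintegral_map (by fun_prop) (by fun_prop)]
  have hs : ∀ x, ENNReal.ofReal ((U x + U (-x)) / 2)
      = ENNReal.ofReal (U x / 2) + ENNReal.ofReal (U (-x) / 2) := fun x => by
    rw [add_div, ENNReal.ofReal_add (by linarith [h0 x]) (by linarith [h0 (-x)])]
  have hh : ∀ x, ENNReal.ofReal (U x)
      = ENNReal.ofReal (U x / 2) + ENNReal.ofReal (U x / 2) := fun x => by
    rw [← ENNReal.ofReal_add (by linarith [h0 x]) (by linarith [h0 x]), add_halves]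
  simp_rw [hs, hh]
  rw [lintegral_add_left (by fun_prop), lintegral_add_left (by fun_prop), hn]

/-- The fourth-order expansion with the coefficients controlled in terms of the step size. -/
theorem LyapunovClass.exists_half_add_le {d q : ℕ} (hq : 4 ≤ q) {δ : ℝ}
    (hδ : δ = 1 / (q : ℝ)) {V : Vec d → ℝ} (hV : LyapunovClass 4 δ V) {K θ : ℝ} (hK : 0 < K)
    (hθ : θ < 1 / 2) :
    ∃ C : ℝ, 0 ≤ C ∧ ∀ Δ : ℝ, 0 < Δ → Δ ≤ 1 → ∀ (z a G : Vec d) (σ t : ℝ), 0 ≤ σ → 0 ≤ t →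
      (1 + V z) ^ (1 - 2 * δ) * ‖a‖ ^ 2 ≤ V z * (K * Δ ^ (-θ)) ^ 2 →
      (1 + V z) ^ (1 - 2 * δ) * σ ^ 2 ≤ V z * (K * Δ ^ (-θ)) →
      ‖G‖ ≤ Real.sqrt Δ * (σ * t) →
      (V (z + (Δ • a + G)) + V (z + (Δ • a - G))) / 2 ≤
        V z + Δ * iteratedFDeriv ℝ 1 V z (fun _ => a) + iteratedFDeriv ℝ 2 V z (fun _ => G) / 2
          + C * (V z * (Δ ^ (1 - θ)) ^ 2) * (1 + t) ^ q := by
  obtain ⟨c, hc0, hc⟩ := hV.deriv_bound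
  have hq0 : (0 : ℝ) < q := by exact_mod_cast (by lia : 0 < q)
  have hδ0 : 0 < δ := by rw [hδ]; positivity
  -- The drift contributes `K²` (through `ε² ≤ ε`) and the diffusion `K` to the bound on `r² = α² +
  -- β²`.
  obtain ⟨κ, hκ0, hκ2⟩ : ∃ κ : ℝ, 0 ≤ κ ∧ κ ^ 2 = K ^ 2 + K :=
    ⟨Real.sqrt (K ^ 2 + K), Real.sqrt_nonneg _, Real.sq_sqrt (by positivity)⟩
  refine ⟨c * (K ^ 2 + K * κ ^ 2 + κ ^ 4 * (1 + c * δ * κ) ^ (q - 4)), by positivity,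
    fun Δ hΔ0 hΔ1 z a G σ t hσ ht ha hA hG => ?_⟩
  obtain ⟨ε, hε⟩ : ∃ ε, ε = Δ ^ (1 - θ) := ⟨_, rfl⟩
  have hε0 : 0 < ε := hε ▸ Real.rpow_pos_of_pos hΔ0 _
  have hε1 : ε ≤ 1 := hε ▸ Real.rpow_le_one hΔ0.le hΔ1 (by linarith)
  have hεΔ : ε = Δ * Δ ^ (-θ) := by
    rw [hε, sub_eq_add_neg, Real.rpow_add hΔ0, Real.rpow_one]
  have hVz := hV.nonneg z
  have hW0 : 0 < 1 + V z := by linarith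
  obtain ⟨S, hS⟩ : ∃ S, S = (1 + V z) ^ δ := ⟨_, rfl⟩
  have hS0 : 0 < S := hS ▸ Real.rpow_pos_of_pos hW0 _
  have hS2 : (1 + V z) ^ (1 - 2 * δ) = (1 + V z) / S ^ 2 := by
    rw [Real.rpow_sub hW0, Real.rpow_one, hS, ← Real.rpow_natCast ((1 + V z) ^ δ),
      ← Real.rpow_mul hW0.le, mul_comm δ]
    norm_num
  rw [hS2] at ha hA
  -- `α` and `β` are the drift and diffusion displacements in the unit `S`; `r` below dominates
  -- both.
  obtain ⟨α, hα⟩ : ∃ α, α = Δ * ‖a‖ / S := ⟨_, rfl⟩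
  obtain ⟨β, hβ⟩ : ∃ β, β = Real.sqrt Δ * σ / S := ⟨_, rfl⟩
  have hα0 : 0 ≤ α := by rw [hα]; positivity
  have hβ0 : 0 ≤ β := by rw [hβ]; positivity
  obtain ⟨r, hr0, hr2⟩ : ∃ r : ℝ, 0 ≤ r ∧ r ^ 2 = α ^ 2 + β ^ 2 :=
    ⟨Real.sqrt (α ^ 2 + β ^ 2), Real.sqrt_nonneg _, Real.sq_sqrt (by positivity)⟩
  have h1 : (1 + V z) * α ^ 2 ≤ V z * (K * ε) ^ 2 := by
    calc (1 + V z) * α ^ 2 = Δ ^ 2 * ((1 + V z) / S ^ 2 * ‖a‖ ^ 2) := by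
          rw [hα]; field_simp
      _ ≤ Δ ^ 2 * (V z * (K * Δ ^ (-θ)) ^ 2) := by gcongr
      _ = _ := by rw [hεΔ]; ring
  have h1b : (1 + V z) * β ^ 2 ≤ V z * (K * ε) := by
    calc (1 + V z) * β ^ 2 = Real.sqrt Δ ^ 2 * ((1 + V z) / S ^ 2 * σ ^ 2) := by
          rw [hβ]; field_simp
      _ ≤ Real.sqrt Δ ^ 2 * (V z * (K * Δ ^ (-θ))) := by gcongr
      _ = _ := by rw [hεΔ, Real.sq_sqrt hΔ0.le]; ring
  have h2 : (1 + V z) * r ^ 2 ≤ V z * (κ ^ 2 * ε) := by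
    have h3 : V z * (K * ε) ^ 2 ≤ V z * (K ^ 2 * ε) := by
      have h4 : ε ^ 2 ≤ ε := by nlinarith
      rw [mul_pow]
      gcongr
    rw [hr2, hκ2]
    linarith
  have hαr : α ≤ r := by
    refine (pow_le_pow_iff_left₀ hα0 hr0 two_ne_zero).1 ?_
    linarith [sq_nonneg β]
  have hβr : β ≤ r := by
    refine (pow_le_pow_iff_left₀ hβ0 hr0 two_ne_zero).1 ?_
    linarith [sq_nonneg α]
  have hF : ‖Δ • a‖ ≤ (1 + V z) ^ δ * α := by
    rw [← hS, norm_smul, Real.norm_of_nonneg hΔ0.le, hα, mul_div_cancel₀ _ hS0.ne']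
  have hG' : ‖G‖ ≤ (1 + V z) ^ δ * (r * t) := by
    rw [← hS]
    calc ‖G‖ ≤ Real.sqrt Δ * (σ * t) := hG
      _ = S * (β * t) := by rw [hβ]; field_simp
      _ ≤ _ := by gcongr
  have k1 := hV.half_add_le hq hδ hc0 hc z (Δ • a) G ht hα0 hαr hF hG'
  have k2 := remainder_le hq (v := V z) (W := 1 + V z) (b := c * δ) (by linarith) hW0
    hVz hα0 hr0 ht hε0 hε1 hK hκ0 (by positivity) h1 h2
  have k3 := mul_le_mul_of_nonneg_left k2 hc0.le
  have k5 : iteratedFDeriv ℝ 1 V z (fun _ => Δ • a)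
      = Δ * iteratedFDeriv ℝ 1 V z (fun _ => a) := by
    simp [iteratedFDeriv_one_apply]
  rw [k5, mul_assoc c] at k1
  rw [← hε]
  refine k1.trans ((add_le_add_right k3 _).trans_eq ?_)
  ring

/-- One step of the untruncated scheme changes the mean of `V` by the Euler increment of the
generator, up to `C V(z) Δ^(2 - 2θ)`. -/
theorem LyapunovClass.exists_one_step_le {d q : ℕ} (m : ℕ) (hq : 4 ≤ q) {δ : ℝ}
    (hδ : δ = 1 / (q : ℝ)) {V : Vec d → ℝ} (hV : LyapunovClass 4 δ V) {K θ : ℝ} (hK : 0 < K)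
    (hθ : θ < 1 / 2) :
    ∃ C : ℝ, 0 ≤ C ∧ ∀ Δ : ℝ, 0 < Δ → Δ ≤ 1 → ∀ (z a : Vec d) (A : Matrix (Fin d) (Fin m) ℝ),
      (1 + V z) ^ (1 - 2 * δ) * ‖a‖ ^ 2 ≤ V z * (K * Δ ^ (-θ)) ^ 2 →
      (1 + V z) ^ (1 - 2 * δ) * traceNorm A ^ 2 ≤ V z * (K * Δ ^ (-θ)) →
      ∫⁻ x, ENNReal.ofReal (V (z + Δ • a + mulVecE A (Real.sqrt Δ • x))) ∂(stdGaussian (Vec m))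
        ≤ ENNReal.ofReal (V z + Δ * (iteratedFDeriv ℝ 1 V z (fun _ => a)
            + 1 / 2 * Matrix.trace (Aᵀ * hessian V z * A)) + C * (V z * (Δ ^ (1 - θ)) ^ 2)) := by
  obtain ⟨C₀, hC₀, hsym⟩ := hV.exists_half_add_le hq hδ hK hθ
  have hMq0 : 0 ≤ ∫ x : Vec m, (1 + ‖x‖) ^ q ∂(stdGaussian (Vec m)) :=
    integral_nonneg fun x => by positivity
  refine ⟨C₀ * ∫ x : Vec m, (1 + ‖x‖) ^ q ∂(stdGaussian (Vec m)), by positivity,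
    fun Δ hΔ0 hΔ1 z a A ha hA => ?_⟩
  have hG : ∀ x : Vec m, ‖mulVecE A (Real.sqrt Δ • x)‖ ≤ Real.sqrt Δ * (traceNorm A * ‖x‖) := by
    intro x
    rw [mulVecE_smul, norm_smul, Real.norm_of_nonneg (Real.sqrt_nonneg _)]
    gcongr
    exact norm_mulVecE_le _ _
  obtain ⟨U, hU⟩ : ∃ U : Vec m → ℝ,
    U = fun x => V (z + Δ • a + mulVecE A (Real.sqrt Δ • x)) := ⟨_, rfl⟩
  have hU0 : ∀ x, 0 ≤ U x := fun x => by rw [hU]; exact hV.nonneg _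
  have hUm : Measurable U := by
    rw [hU]
    exact hV.contDiff.continuous.measurable.comp
      (measurable_const.add ((measurable_mulVecE A).comp (by fun_prop)))
  have hquad : ∀ x : Vec m,
      iteratedFDeriv ℝ 2 V z (fun _ => mulVecE A (Real.sqrt Δ • x))
        = Δ * iteratedFDeriv ℝ 2 V z (fun _ => mulVecE A x) := by
    intro x
    rw [mulVecE_smul,
      (iteratedFDeriv ℝ 2 V z).map_smul_univ (fun _ => Real.sqrt Δ) (fun _ => mulVecE A x)]
    simp [Real.sq_sqrt hΔ0.le]
  obtain ⟨D, hD⟩ : ∃ D, D = V z + Δ * iteratedFDeriv ℝ 1 V z (fun _ => a) := ⟨_, rfl⟩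
  obtain ⟨E, hE⟩ : ∃ E, E = C₀ * (V z * (Δ ^ (1 - θ)) ^ 2) := ⟨_, rfl⟩
  obtain ⟨Q, hQ⟩ : ∃ Q : Vec m → ℝ, Q = fun x =>
    D + Δ / 2 * iteratedFDeriv ℝ 2 V z (fun _ => mulVecE A x) + E * (1 + ‖x‖) ^ q := ⟨_, rfl⟩
  have hUQ : ∀ x, (U x + U (-x)) / 2 ≤ Q x := by
    intro x
    have k1 := hsym Δ hΔ0 hΔ1 z a (mulVecE A (Real.sqrt Δ • x)) (traceNorm A) ‖x‖
      (Real.sqrt_nonneg _) (norm_nonneg x) ha hA (hG x)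
    have k4 : U x + U (-x) = V (z + (Δ • a + mulVecE A (Real.sqrt Δ • x)))
        + V (z + (Δ • a - mulVecE A (Real.sqrt Δ • x))) := by
      simp only [hU, smul_neg, mulVecE_neg, sub_eq_add_neg, add_assoc]
    rw [hquad, ← hD, ← hE, ← k4] at k1
    rw [hQ]
    refine k1.trans_eq ?_
    ring
  obtain ⟨hi, hint⟩ := integral_hessian_mulVecE V z A
  have hi0 : Integrable (fun x : Vec m => Δ / 2 * iteratedFDeriv ℝ 2 V z (fun _ => mulVecE A x))
    (stdGaussian (Vec m)) := hi.const_mul _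
  have hi1 : Integrable (fun x : Vec m =>
      D + Δ / 2 * iteratedFDeriv ℝ 2 V z (fun _ => mulVecE A x)) (stdGaussian (Vec m)) :=
    (integrable_const D).add hi0
  have hi2 : Integrable (fun x : Vec m => E * (1 + ‖x‖) ^ q)
      (stdGaussian (Vec m)) := (integrable_one_add_norm_pow q).const_mul _
  have hQi : Integrable Q (stdGaussian (Vec m)) := hQ ▸ hi1.add hi2
  have hQ0 : ∀ x, 0 ≤ Q x := fun x =>
    le_trans (by linarith [hU0 x, hU0 (-x)]) (hUQ x)
  calc ∫⁻ x, ENNReal.ofReal (V (z + Δ • a + mulVecE A (Real.sqrt Δ • x))) ∂(stdGaussian (Vec m))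
      = ∫⁻ x, ENNReal.ofReal (U x) ∂(stdGaussian (Vec m)) := by rw [hU]
    _ = ∫⁻ x, ENNReal.ofReal ((U x + U (-x)) / 2) ∂(stdGaussian (Vec m)) :=
        lintegral_stdGaussian_symm hUm hU0
    _ ≤ ∫⁻ x, ENNReal.ofReal (Q x) ∂(stdGaussian (Vec m)) :=
        lintegral_mono fun x => ENNReal.ofReal_le_ofReal (hUQ x)
    _ = ENNReal.ofReal (∫ x, Q x ∂(stdGaussian (Vec m))) :=
        (ofReal_integral_eq_lintegral_ofReal hQi (ae_of_all _ hQ0)).symm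
    _ = _ := by
        congr 1
        rw [hQ, integral_add hi1 hi2, integral_add (integrable_const D) hi0,
          integral_const_mul, integral_const_mul, hint, integral_const, probReal_univ, one_smul,
          hD, hE]
        ring

/-! ### Coefficients and truncation -/

theorem traceNorm_zero {d m : ℕ} : traceNorm (0 : Matrix (Fin d) (Fin m) ℝ) = 0 := by
  simp [traceNorm]

/-- Clear the denominators and use `Λ ≤ 1`; positivity of `Λ` comes from `w ≥ μ V`. The origin,
which the growth condition excludes, is covered by `f 0 = 0` and `g 0 = 0`. -/
theorem IsGrowthFunction.coeff_bounds {d m : ℕ} {δ μ : ℝ} {f : Vec d → Vec d}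
    {g : Vec d → Matrix (Fin d) (Fin m) ℝ} {V w : Vec d → ℝ} {φ : ℝ → ℝ}
    (hφ : IsGrowthFunction δ f g V w φ) (hf0 : f 0 = 0) (hg0 : g 0 = 0)
    (hV0 : ∀ x, 0 ≤ V x) (hVz : ∀ x, V x = 0 ↔ x = 0) (hμ : 0 < μ) (hwV : ∀ x, μ * V x ≤ w x)
    {u : ℝ} (hu : 1 ≤ u) {z : Vec d} (hz : ‖z‖ ≤ u) :
    (1 + V z) ^ (1 - 2 * δ) * ‖f z‖ ^ 2 ≤ V z * φ u ^ 2 ∧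
      (1 + V z) ^ (1 - 2 * δ) * traceNorm (g z) ^ 2 ≤ V z * φ u := by
  have hφ0 : 0 ≤ φ u := hφ.nonneg u (by linarith)
  rcases eq_or_ne z 0 with rfl | hz0
  · simp [hf0, hg0, traceNorm_zero, (hVz 0).2 rfl]
  have hVpos : 0 < V z := lt_of_le_of_ne (hV0 z) fun h => hz0 ((hVz z).1 h.symm)
  have hΛ0 : 0 < Lam V w z :=
    lt_min one_pos (div_pos ((mul_pos hμ hVpos).trans_le (hwV z)) hVpos)
  obtain ⟨L, hL⟩ : ∃ L, L = Lam V w z * V z := ⟨_, rfl⟩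
  have hL0 : 0 < L := hL ▸ mul_pos hΛ0 hVpos
  have hLV : L ≤ V z := hL ▸ mul_le_of_le_one_left hVpos.le (min_le_left _ _)
  have hb := hφ.bound u hu z (norm_pos_iff.2 hz0) hz
  rw [max_le_iff, ← hL, div_le_iff₀ (Real.rpow_pos_of_pos hL0 _), div_le_iff₀ hL0] at hb
  have hW0 : 0 ≤ 1 + V z := by linarith
  constructor
  · have e1 : ((1 + V z) ^ (1 / 2 - δ)) ^ 2 = (1 + V z) ^ (1 - 2 * δ) := by
      rw [← Real.rpow_natCast, ← Real.rpow_mul hW0]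
      congr 1
      push_cast
      ring
    have e2 : (L ^ (1 / 2 : ℝ)) ^ 2 = L := by
      rw [← Real.sqrt_eq_rpow, Real.sq_sqrt hL0.le]
    have h := pow_le_pow_left₀ (by positivity) hb.1 2
    rw [mul_pow, mul_pow, e1, e2] at h
    refine h.trans ?_
    rw [mul_comm]
    gcongr
  · refine hb.2.trans ?_
    rw [mul_comm]
    gcongr

/-- The intermediate value theorem on `[u, ∞)` shows that the level is attained, so
`Function.invFunOn` returns a genuine preimage and not its default value. -/
theorem IsGrowthFunction.truncationRadius_spec {d m : ℕ} {δ : ℝ} {f : Vec d → Vec d}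
    {g : Vec d → Matrix (Fin d) (Fin m) ℝ} {V w : Vec d → ℝ} {φ : ℝ → ℝ}
    (hφ : IsGrowthFunction δ f g V w φ) {u K θ Δ : ℝ} (hu : 0 ≤ u) (h : φ u ≤ K * Δ ^ (-θ)) :
    u ≤ truncationRadius φ K θ Δ ∧ φ (truncationRadius φ K θ Δ) = K * Δ ^ (-θ) := by
  have hex : ∃ a ∈ Ici (0 : ℝ), φ a = K * Δ ^ (-θ) := by
    obtain ⟨a, ha, hae⟩ := intermediate_value_Ici
      (hφ.continuousOn.mono (Ici_subset_Ici.2 hu)) hφ.tendsto_atTop h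
    exact ⟨a, hu.trans ha, hae⟩
  have heq : φ (truncationRadius φ K θ Δ) = K * Δ ^ (-θ) := Function.invFunOn_eq hex
  refine ⟨?_, heq⟩
  refine (hφ.strictMonoOn.le_iff_le hu (Function.invFunOn_mem hex)).1 ?_
  exact h.trans_eq heq.symm

theorem norm_radialTruncation_le {d : ℕ} {R : ℝ} (hR : 0 ≤ R) (x : Vec d) :
    ‖radialTruncation R x‖ ≤ R := by
  rcases eq_or_ne x 0 with rfl | hx
  · simpa [radialTruncation] using hR
  rw [radialTruncation, norm_smul, norm_smul, norm_inv, norm_norm,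
    inv_mul_cancel₀ (norm_ne_zero_iff.2 hx), mul_one,
    Real.norm_of_nonneg (le_min (norm_nonneg _) hR)]
  exact min_le_right _ _

theorem radialTruncation_le {d : ℕ} {V : Vec d → ℝ}
    (hV : ∀ x : Vec d, ∀ ε : ℝ, 0 < ε → ε ≤ 1 → V (ε • x) ≤ V x) {R : ℝ} (hR : 0 < R)
    (x : Vec d) : V (radialTruncation R x) ≤ V x := by
  rcases eq_or_ne x 0 with rfl | hx
  · simp [radialTruncation]
  have hx0 : 0 < ‖x‖ := norm_pos_iff.2 hx
  rw [radialTruncation, smul_smul]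
  refine hV x _ (mul_pos (lt_min hx0 hR) (inv_pos.2 hx0)) ?_
  rw [← div_eq_mul_inv, div_le_one hx0]
  exact min_le_left _ _

theorem measurable_radialTruncation {d : ℕ} (R : ℝ) :
    Measurable (radialTruncation R : Vec d → Vec d) := by
  unfold radialTruncation
  fun_prop

theorem LocallyLipschitzCoeffs.lipschitzOn {d m : ℕ} {f : Vec d → Vec d}
    {g : Vec d → Matrix (Fin d) (Fin m) ℝ} (h : LocallyLipschitzCoeffs f g) (x : Vec d) :
    ∃ C : ℝ, ∀ y ∈ Metric.ball x 1, ‖f y - f x‖ ≤ C * ‖y - x‖ ∧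
      traceNorm (g y - g x) ≤ C * ‖y - x‖ := by
  obtain ⟨C, _, hC⟩ := h (‖x‖ + 1) (by positivity)
  refine ⟨C, fun y hy => ?_⟩
  have hy' : ‖y‖ ≤ ‖x‖ + 1 := by
    rw [mem_ball_iff_norm] at hy
    have := norm_le_norm_add_norm_sub' y x
    linarith
  exact max_le_iff.1 (hC y x (max_le hy' (by linarith)))

theorem continuous_of_norm_sub_le {E F : Type*} [SeminormedAddCommGroup E]
    [SeminormedAddCommGroup F] {h : E → F}
    (hh : ∀ x, ∃ C : ℝ, ∀ y ∈ Metric.ball x 1, ‖h y - h x‖ ≤ C * ‖y - x‖) : Continuous h := by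
  refine continuous_iff_continuousAt.2 fun x => ?_
  obtain ⟨C, hC⟩ := hh x
  refine tendsto_iff_norm_sub_tendsto_zero.2 ?_
  refine squeeze_zero' (Eventually.of_forall fun _ => norm_nonneg _)
    (eventually_of_mem (Metric.ball_mem_nhds x one_pos) hC) ?_
  have : Tendsto (fun y => C * ‖y - x‖) (𝓝 x) (𝓝 (C * ‖x - x‖)) :=
    Continuous.tendsto (by fun_prop) x
  simpa using this

theorem abs_apply_le_traceNorm {d m : ℕ} (A : Matrix (Fin d) (Fin m) ℝ) (i : Fin d)
    (j : Fin m) : |A i j| ≤ traceNorm A := by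
  refine Real.abs_le_sqrt ?_
  calc A i j ^ 2 ≤ ∑ l, A i l ^ 2 :=
        Finset.single_le_sum (f := fun l => A i l ^ 2) (fun _ _ => sq_nonneg _)
          (Finset.mem_univ j)
    _ ≤ _ := Finset.single_le_sum (f := fun k => ∑ l, A k l ^ 2)
          (fun _ _ => Finset.sum_nonneg fun _ _ => sq_nonneg _) (Finset.mem_univ i)

/-- Continuity serves to make one step of the scheme jointly measurable in state and increment. -/
theorem LocallyLipschitzCoeffs.continuous {d m : ℕ} {f : Vec d → Vec d}
    {g : Vec d → Matrix (Fin d) (Fin m) ℝ} (h : LocallyLipschitzCoeffs f g) :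
    Continuous f ∧ Continuous g := by
  refine ⟨continuous_of_norm_sub_le fun x => ?_, ?_⟩
  · obtain ⟨C, hC⟩ := h.lipschitzOn x
    exact ⟨C, fun y hy => (hC y hy).1⟩
  · refine continuous_pi fun i => continuous_pi fun j => continuous_of_norm_sub_le fun x => ?_
    obtain ⟨C, hC⟩ := h.lipschitzOn x
    exact ⟨C, fun y hy => (abs_apply_le_traceNorm (g y - g x) i j).trans (hC y hy).2⟩

/-- One step of the truncated scheme, as a function of the state and of the increment. -/
def schemeStep {d m : ℕ} (f : Vec d → Vec d) (g : Vec d → Matrix (Fin d) (Fin m) ℝ)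
    (R Δ : ℝ) (z : Vec d) (b : Vec m) : Vec d :=
  radialTruncation R (z + Δ • f z + mulVecE (g z) b)

theorem measurable_schemeStep {d m : ℕ} {f : Vec d → Vec d}
    {g : Vec d → Matrix (Fin d) (Fin m) ℝ} (hf : Continuous f) (hg : Continuous g) (R Δ : ℝ) :
    Measurable fun p : Vec d × Vec m => schemeStep f g R Δ p.1 p.2 := by
  refine (measurable_radialTruncation R).comp (Continuous.measurable ?_)
  have hmul : Continuous fun p : Vec d × Vec m => mulVecE (g p.1) p.2 := by
    unfold mulVecE
    refine (PiLp.continuous_toLp 2 _).comp ?_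
    exact (hg.comp continuous_fst).matrix_mulVec ((PiLp.continuous_ofLp 2 _).comp continuous_snd)
  fun_prop

/-! ### The driving increments -/

theorem IsBrownianMotion.measurable_increment {Ω : Type*} [MeasurableSpace Ω] {m : ℕ}
    {B : ℝ≥0 → Ω → Vec m} {P : Measure Ω} (hB : IsBrownianMotion B P) (Δ : ℝ) (k : ℕ) :
    Measurable fun ω => increment B Δ ω k :=
  (hB.measurable _).sub (hB.measurable _)

theorem IsBrownianMotion.iIndepFun_increment {Ω : Type*} [MeasurableSpace Ω] {m : ℕ}
    {B : ℝ≥0 → Ω → Vec m} {P : Measure Ω} (hB : IsBrownianMotion B P) {Δ : ℝ} (hΔ : 0 ≤ Δ) :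
    iIndepFun (fun (k : ℕ) ω => increment B Δ ω k) P := by
  have hmono : Monotone fun k : ℕ => Real.toNNReal ((k : ℝ) * Δ) := fun a b hab => by
    refine Real.toNNReal_mono ?_
    gcongr
  have := hB.indepIncrements.nat hmono
  simpa only [increment, Nat.cast_add, Nat.cast_one] using this

theorem map_toLp_pi_gaussianReal {m : ℕ} (v : ℝ≥0) :
    (Measure.pi fun _ : Fin m => gaussianReal 0 v).map (WithLp.toLp 2)
      = (stdGaussian (Vec m)).map (fun x => Real.sqrt v • x) := by
  have hv : gaussianReal 0 v = (gaussianReal 0 1).map (fun x => Real.sqrt v * x) := by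
    rw [gaussianReal_map_const_mul]
    congr 1
    · simp
    · ext; simp
  have hpi : (Measure.pi fun _ : Fin m => gaussianReal 0 v)
      = (Measure.pi fun _ : Fin m => gaussianReal 0 1).map
        (fun (x : Fin m → ℝ) i => Real.sqrt v * x i) := by
    have hσ : ∀ _ : Fin m, SigmaFinite ((gaussianReal 0 1).map (fun x => Real.sqrt v * x)) :=
      fun _ => by rw [← hv]; infer_instance
    rw [Measure.pi_map_pi (f := fun _ x => Real.sqrt v * x) (fun _ => by fun_prop)]
    simp only [hv]
  rw [hpi, ← map_pi_eq_stdGaussian, Measure.map_map (by fun_prop) (by fun_prop),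
    Measure.map_map (by fun_prop) (by fun_prop)]
  rfl

theorem IsBrownianMotion.map_increment {Ω : Type*} [MeasurableSpace Ω] {m : ℕ}
    {B : ℝ≥0 → Ω → Vec m} {P : Measure Ω} (hB : IsBrownianMotion B P) {Δ : ℝ} (hΔ : 0 ≤ Δ)
    (k : ℕ) :
    P.map (fun ω => increment B Δ ω k)
      = (stdGaussian (Vec m)).map (fun x => Real.sqrt Δ • x) := by
  have hlaw := hB.law_sub (Real.toNNReal ((k : ℝ) * Δ)) (Real.toNNReal (((k : ℝ) + 1) * Δ))
    (Real.toNNReal_mono (by nlinarith))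
  have hsub : Real.toNNReal (((k : ℝ) + 1) * Δ) - Real.toNNReal ((k : ℝ) * Δ)
      = Real.toNNReal Δ := by
    rw [add_mul, one_mul, Real.toNNReal_add (by positivity) hΔ, add_tsub_cancel_left]
  rw [hsub] at hlaw
  have hm : (fun ω => increment B Δ ω k) = WithLp.toLp 2 ∘ fun ω (i : Fin m) =>
      B (Real.toNNReal (((k : ℝ) + 1) * Δ)) ω i - B (Real.toNNReal ((k : ℝ) * Δ)) ω i := rfl
  rw [hm, ← AEMeasurable.map_map_of_aemeasurable (by fun_prop) hlaw.aemeasurable, hlaw.map_eq,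
    map_toLp_pi_gaussianReal, Real.coe_toNNReal _ hΔ]

/-! ### Recursions driven by independent noise -/

/-- The state reached by the recursion `Z (k+1) = Φ (Z k) (b k)` at time `k` is independent of the
noise `b k`. -/
theorem indepFun_recursion {Ω E F : Type*} [mΩ : MeasurableSpace Ω] [MeasurableSpace E]
    [mF : MeasurableSpace F] {P : Measure Ω} {Φ : E → F → E}
    (hΦ : Measurable fun p : E × F => Φ p.1 p.2) {b : ℕ → Ω → F} (hbm : ∀ k, Measurable (b k))
    (hb : iIndepFun b P) {Z : ℕ → Ω → E} {x₀ : E} (hZ0 : ∀ ω, Z 0 ω = x₀)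
    (hZ : ∀ k ω, Z (k + 1) ω = Φ (Z k ω) (b k ω)) (k : ℕ) :
    Measurable (Z k) ∧ IndepFun (Z k) (b k) P := by
  have hle : ∀ k, (⨆ i ∈ {i : ℕ | i < k}, mF.comap (b i)) ≤ mΩ := fun k =>
    iSup₂_le fun i _ => (hbm i).comap_le
  -- The induction carries the stronger fact that `Z k` is a function of the noises before time `k`.
  have hmeas : ∀ k, Measurable[⨆ i ∈ {i : ℕ | i < k}, mF.comap (b i)] (Z k) := by
    intro k
    induction k with
    | zero =>
      have : Z 0 = fun _ => x₀ := funext hZ0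
      rw [this]
      exact measurable_const
    | succ k ih =>
      have e : Z (k + 1) = fun ω => Φ (Z k ω) (b k ω) := funext (hZ k)
      rw [e]
      have h1 : Measurable[⨆ i ∈ {i : ℕ | i < k + 1}, mF.comap (b i)] (Z k) :=
        ih.mono (biSup_mono fun i (hi : i < k) => hi.trans (Nat.lt_succ_self k)) le_rfl
      have h2 : Measurable[⨆ i ∈ {i : ℕ | i < k + 1}, mF.comap (b i)] (b k) :=
        (comap_measurable (b k)).mono
          (le_biSup (fun i => mF.comap (b i)) (show k < k + 1 from Nat.lt_succ_self k)) le_rfl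
      exact hΦ.comp (h1.prodMk h2)
  refine ⟨(hmeas k).mono (hle k) le_rfl, ?_⟩
  have hi := indep_iSup_of_disjoint (fun i => (hbm i).comap_le) hb.iIndep
    (S := {i : ℕ | i < k}) (T := {k}) (by simp)
  simp only [mem_singleton_iff, iSup_iSup_eq_left] at hi
  rw [IndepFun_iff_Indep]
  exact indep_of_indep_of_le_left hi (hmeas k).comap_le

/-- If one step contracts the mean of `W` by the factor `ρ` on a set that the recursion never
leaves, then the mean of `W` decays geometrically. -/
theorem lintegral_recursion_le {Ω E F : Type*} [MeasurableSpace Ω] [MeasurableSpace E]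
    [MeasurableSpace F] {P : Measure Ω} [IsProbabilityMeasure P] {Φ : E → F → E}
    (hΦ : Measurable fun p : E × F => Φ p.1 p.2) {b : ℕ → Ω → F} (hbm : ∀ k, Measurable (b k))
    (hb : iIndepFun b P) {ν : Measure F} (hν : ∀ k, P.map (b k) = ν) {Z : ℕ → Ω → E} {x₀ : E}
    (hZ0 : ∀ ω, Z 0 ω = x₀) (hZ : ∀ k ω, Z (k + 1) ω = Φ (Z k ω) (b k ω)) {W : E → ℝ≥0∞}
    (hW : Measurable W) {s : Set E} (hs : ∀ k ω, Z k ω ∈ s) {ρ : ℝ≥0∞}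
    (hstep : ∀ z ∈ s, ∫⁻ y, W (Φ z y) ∂ν ≤ ρ * W z) (k : ℕ) :
    ∫⁻ ω, W (Z k ω) ∂P ≤ ρ ^ k * W x₀ := by
  induction k with
  | zero => simp [hZ0]
  | succ k ih =>
    obtain ⟨hZm, hind⟩ := indepFun_recursion hΦ hbm hb hZ0 hZ k
    -- Independence makes the joint law a product, so the noise can be integrated out first with the
    -- state frozen.
    have hprod := (indepFun_iff_map_prod_eq_prod_map_map hZm.aemeasurable
      (hbm k).aemeasurable).1 hind
    have hνP : IsProbabilityMeasure ν := hν k ▸ Measure.isProbabilityMeasure_map (hbm k).aemeasurable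
    have hWΦ : Measurable fun p : E × F => W (Φ p.1 p.2) := hW.comp hΦ
    calc ∫⁻ ω, W (Z (k + 1) ω) ∂P
        = ∫⁻ p, W (Φ p.1 p.2) ∂(P.map fun ω => (Z k ω, b k ω)) := by
          rw [lintegral_map hWΦ (hZm.prodMk (hbm k))]
          simp only [hZ]
      _ = ∫⁻ z, ∫⁻ y, W (Φ z y) ∂ν ∂(P.map (Z k)) := by
          rw [hprod, hν k, lintegral_prod _ hWΦ.aemeasurable]
      _ = ∫⁻ ω, ∫⁻ y, W (Φ (Z k ω) y) ∂ν ∂P :=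
          lintegral_map hWΦ.lintegral_prod_right' hZm
      _ ≤ ∫⁻ ω, ρ * W (Z k ω) ∂P := lintegral_mono fun ω => hstep _ (hs k ω)
      _ = ρ * ∫⁻ ω, W (Z k ω) ∂P := lintegral_const_mul _ (hW.comp hZm)
      _ ≤ ρ * (ρ ^ k * W x₀) := by gcongr
      _ = ρ ^ (k + 1) * W x₀ := by rw [pow_succ', mul_assoc]

/-! ### Exponential rates -/

theorem log_div_le_of_le_exp {a : ℝ≥0∞} {s r : ℝ} (hs : 0 < s)
    (ha : a ≤ ENNReal.ofReal (Real.exp (r * s))) : ENNReal.log a / (s : EReal) ≤ (r : EReal) := by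
  rw [EReal.div_le_iff_le_mul (by exact_mod_cast hs) (EReal.coe_ne_top s)]
  refine (ENNReal.log_le_log ha).trans_eq ?_
  rw [ENNReal.log_ofReal_of_pos (Real.exp_pos _), Real.log_exp, mul_comm, EReal.coe_mul]

theorem limsup_log_div_le {a : ℕ → ℝ≥0∞} {Δ r : ℝ} (hΔ : 0 < Δ)
    (ha : ∀ᶠ k : ℕ in atTop, a k ≤ ENNReal.ofReal (Real.exp (r * ((k : ℝ) * Δ)))) :
    limsup (fun k : ℕ => ENNReal.log (a k) / (((k : ℝ) * Δ : ℝ) : EReal)) atTop ≤ (r : EReal) := by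
  refine limsup_le_of_le (h := ?_)
  filter_upwards [ha, eventually_gt_atTop 0] with k hk hk0
  exact log_div_le_of_le_exp (by positivity) hk

/-- Geometric decay of means gives the same exponential rate for the means and, almost surely, for
the paths, up to an arbitrarily small loss. -/
theorem limsup_log_le_of_lintegral_le {Ω : Type*} [MeasurableSpace Ω] {P : Measure Ω}
    {Y : ℕ → Ω → ℝ≥0∞} (hY : ∀ k, Measurable (Y k)) {Δ r r' : ℝ} (hΔ : 0 < Δ) (hr : r' < r)
    {M : ℝ≥0∞} (hM : M ≠ ⊤)
    (h : ∀ k, ∫⁻ ω, Y k ω ∂P ≤ ENNReal.ofReal (Real.exp (r' * Δ)) ^ k * M) :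
    limsup (fun k : ℕ => ENNReal.log (∫⁻ ω, Y k ω ∂P) / (((k : ℝ) * Δ : ℝ) : EReal)) atTop
        ≤ (r : EReal) ∧
      ∀ᵐ ω ∂P, limsup (fun k : ℕ => ENNReal.log (Y k ω) / (((k : ℝ) * Δ : ℝ) : EReal)) atTop
        ≤ (r : EReal) := by
  -- The weights `exp (-r k Δ)` leave weighted means bounded by a geometric series of ratio `γ < 1`;
  -- a weighted term at most `1` is exactly the rate `r`.
  obtain ⟨e, he⟩ : ∃ e : ℕ → ℝ≥0∞, e = fun k : ℕ =>
    ENNReal.ofReal (Real.exp (-(r * ((k : ℝ) * Δ)))) := ⟨_, rfl⟩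
  have hinv : ∀ (k : ℕ) (a : ℝ≥0∞), e k * a ≤ 1 →
      a ≤ ENNReal.ofReal (Real.exp (r * ((k : ℝ) * Δ))) := by
    intro k a ha
    calc a = ENNReal.ofReal (Real.exp (r * ((k : ℝ) * Δ))) * (e k * a) := by
          rw [he, ← mul_assoc, ← ENNReal.ofReal_mul (Real.exp_pos _).le, ← Real.exp_add]
          simp
      _ ≤ ENNReal.ofReal (Real.exp (r * ((k : ℝ) * Δ))) * 1 := by gcongr
      _ = _ := mul_one _
  obtain ⟨γ, hγ⟩ : ∃ γ : ℝ≥0∞, γ = ENNReal.ofReal (Real.exp ((r' - r) * Δ)) := ⟨_, rfl⟩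
  have hγ1 : γ < 1 := by
    rw [hγ, ← ENNReal.ofReal_one, ENNReal.ofReal_lt_ofReal_iff one_pos, Real.exp_lt_one_iff]
    nlinarith
  have hle : ∀ k, e k * ∫⁻ ω, Y k ω ∂P ≤ γ ^ k * M := by
    intro k
    calc e k * ∫⁻ ω, Y k ω ∂P ≤ e k * (ENNReal.ofReal (Real.exp (r' * Δ)) ^ k * M) := by
          gcongr; exact h k
      _ = γ ^ k * M := by
          rw [← mul_assoc, he, hγ, ← ENNReal.ofReal_pow (Real.exp_pos _).le,
            ← ENNReal.ofReal_pow (Real.exp_pos _).le, ← ENNReal.ofReal_mul (Real.exp_pos _).le,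
            ← Real.exp_nat_mul, ← Real.exp_nat_mul, ← Real.exp_add]
          congr 3
          ring
  have hsum : ∑' k, γ ^ k * M ≠ ⊤ := by
    rw [ENNReal.tsum_mul_right, ENNReal.tsum_geometric]
    refine ENNReal.mul_ne_top (ENNReal.inv_ne_top.2 (tsub_pos_of_lt hγ1).ne') hM
  have hev : ∀ {a : ℕ → ℝ≥0∞}, ∑' k, a k ≠ ⊤ → ∀ᶠ k in atTop, a k ≤ 1 := fun ha =>
    (ENNReal.tendsto_atTop_zero_of_tsum_ne_top ha).eventually_le_const one_pos
  refine ⟨limsup_log_div_le hΔ ?_, ?_⟩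
  · filter_upwards [hev hsum] with k hk
    exact hinv k _ ((hle k).trans hk)
  -- By Tonelli the weighted series has finite mean, hence converges almost surely, and its terms
  -- are eventually at most `1`.
  · have hfin : ∫⁻ ω, ∑' k, e k * Y k ω ∂P ≠ ⊤ := by
      rw [lintegral_tsum fun k => ((hY k).const_mul _).aemeasurable]
      refine ne_top_of_le_ne_top hsum (ENNReal.tsum_le_tsum fun k => ?_)
      rw [lintegral_const_mul _ (hY k)]
      exact hle k
    have hmeas : Measurable fun ω => ∑' k, e k * Y k ω :=
      Measurable.tsum fun k => (hY k).const_mul _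
    filter_upwards [ae_lt_top hmeas hfin] with ω hω
    refine limsup_log_div_le hΔ ?_
    filter_upwards [hev hω.ne] with k hk
    exact hinv k _ hk

/-! ### Contraction in one step and choice of the step size -/

/-- Within the truncation ball, one step of the scheme contracts the mean of `V` by the factor
`exp (-(μ - ϱ/2) Δ)`. -/
theorem lintegral_schemeStep_le {d m : ℕ} {f : Vec d → Vec d}
    {g : Vec d → Matrix (Fin d) (Fin m) ℝ} {V : Vec d → ℝ} (hVc : Continuous V)
    (hVmono : ∀ x : Vec d, ∀ ε : ℝ, 0 < ε → ε ≤ 1 → V (ε • x) ≤ V x)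
    {R Δ θ C μ ϱ : ℝ} (hR : 0 < R) (hΔ : 0 < Δ) {z : Vec d} (hVz : 0 ≤ V z)
    (hgen : generator f g V z ≤ -(μ * V z)) (hC : C * Δ ^ (1 - 2 * θ) ≤ ϱ / 2)
    (hstep : ∫⁻ x, ENNReal.ofReal (V (z + Δ • f z + mulVecE (g z) (Real.sqrt Δ • x)))
        ∂(stdGaussian (Vec m))
      ≤ ENNReal.ofReal (V z + Δ * (iteratedFDeriv ℝ 1 V z (fun _ => f z)
            + 1 / 2 * Matrix.trace ((g z)ᵀ * hessian V z * g z))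
            + C * (V z * (Δ ^ (1 - θ)) ^ 2))) :
    ∫⁻ y, ENNReal.ofReal (V (schemeStep f g R Δ z y))
        ∂((stdGaussian (Vec m)).map (fun x => Real.sqrt Δ • x))
      ≤ ENNReal.ofReal (Real.exp (-(μ - ϱ / 2) * Δ)) * ENNReal.ofReal (V z) := by
  have hm : Measurable fun y : Vec m => ENNReal.ofReal (V (schemeStep f g R Δ z y)) :=
    (hVc.measurable.comp ((measurable_radialTruncation R).comp
      (measurable_const.add (measurable_mulVecE (g z))))).ennreal_ofReal
  have hpow : (Δ ^ (1 - θ)) ^ 2 = Δ * Δ ^ (1 - 2 * θ) := by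
    rw [← Real.rpow_natCast, ← Real.rpow_mul hΔ.le]
    nth_rewrite 2 [← Real.rpow_one Δ]
    rw [← Real.rpow_add hΔ]
    congr 1
    push_cast
    ring
  rw [lintegral_map hm (by fun_prop)]
  calc ∫⁻ x, ENNReal.ofReal (V (schemeStep f g R Δ z (Real.sqrt Δ • x))) ∂(stdGaussian (Vec m))
      ≤ ∫⁻ x, ENNReal.ofReal (V (z + Δ • f z + mulVecE (g z) (Real.sqrt Δ • x)))
          ∂(stdGaussian (Vec m)) :=
        lintegral_mono fun x => ENNReal.ofReal_le_ofReal (radialTruncation_le hVmono hR _)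
    _ ≤ _ := hstep
    _ ≤ ENNReal.ofReal (Real.exp (-(μ - ϱ / 2) * Δ) * V z) := by
        refine ENNReal.ofReal_le_ofReal ?_
        rw [generator, sum_partialDeriv_one_mul] at hgen
        have h1 := mul_le_mul_of_nonneg_left hgen hΔ.le
        have h2 : C * (V z * (Δ ^ (1 - θ)) ^ 2) ≤ ϱ / 2 * (Δ * V z) := by
          rw [hpow]
          calc C * (V z * (Δ * Δ ^ (1 - 2 * θ))) = C * Δ ^ (1 - 2 * θ) * (Δ * V z) := by ring
            _ ≤ _ := by gcongr
        -- The generator and the error together give the factor `1 - (μ - ϱ/2) Δ`, which `1 + x ≤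
        -- exp x` turns into the exponential.
        have h3 := mul_le_mul_of_nonneg_right (Real.add_one_le_exp (-(μ - ϱ / 2) * Δ)) hVz
        linarith
    _ = _ := ENNReal.ofReal_mul (Real.exp_pos _).le

/-- `Δ^(1-2θ) → 0` because `θ < 1/2`; dividing by `C + 1` covers `C = 0`. -/
theorem exists_step_size {C ϱ θ Δstar : ℝ} (hC : 0 ≤ C) (hϱ : 0 < ϱ) (hθ : θ < 1 / 2)
    (hΔ : 0 < Δstar) :
    ∃ Δ₂ : ℝ, 0 < Δ₂ ∧ Δ₂ ≤ Δstar ∧ ∀ Δ : ℝ, 0 < Δ → Δ ≤ Δ₂ →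
      C * Δ ^ (1 - 2 * θ) ≤ ϱ / 2 := by
  have hb : 0 < ϱ / 2 / (C + 1) := by positivity
  have he : 0 < 1 - 2 * θ := by linarith
  refine ⟨min Δstar ((ϱ / 2 / (C + 1)) ^ (1 - 2 * θ)⁻¹), lt_min hΔ (Real.rpow_pos_of_pos hb _),
    min_le_left _ _, fun Δ h0 h => ?_⟩
  have h1 : Δ ^ (1 - 2 * θ) ≤ ϱ / 2 / (C + 1) := by
    calc Δ ^ (1 - 2 * θ) ≤ ((ϱ / 2 / (C + 1)) ^ (1 - 2 * θ)⁻¹) ^ (1 - 2 * θ) :=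
          Real.rpow_le_rpow h0.le (h.trans (min_le_right _ _)) he.le
      _ = _ := Real.rpow_inv_rpow hb.le he.ne'
  rw [le_div_iff₀ (by positivity)] at h1
  have := Real.rpow_nonneg h0.le (1 - 2 * θ)
  linarith

end VTruncatedEM

end

theorem corollary5p4
    {d m : ℕ} {Ω : Type*} [MeasurableSpace Ω] (P : Measure Ω) [IsProbabilityMeasure P]
    (B : ℝ≥0 → Ω → VTruncatedEM.Vec m) (hB : VTruncatedEM.IsBrownianMotion B P)
    -- the equation, with the equilibrium at the origin
    (f : VTruncatedEM.Vec d → VTruncatedEM.Vec d)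
    (g : VTruncatedEM.Vec d → Matrix (Fin d) (Fin m) ℝ)
    (hfg : VTruncatedEM.LocallyLipschitzCoeffs f g) (hf0 : f 0 = 0) (hg0 : g 0 = 0)
    (x₀ : VTruncatedEM.Vec d)
    -- the Lyapunov function
    (δ : ℝ) (hδ : ∃ q : ℕ, 4 ≤ q ∧ δ = 1 / (q : ℝ))
    (V : VTruncatedEM.Vec d → ℝ) (hV : VTruncatedEM.LyapunovClass 4 δ V)
    (hVmono : ∀ x : VTruncatedEM.Vec d, ∀ ε : ℝ, 0 < ε → ε ≤ 1 → V (ε • x) ≤ V x)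
    (w : VTruncatedEM.Vec d → ℝ) (hwc : Continuous w) (hw0 : ∀ x, 0 ≤ w x)
    (hLV : ∀ x, VTruncatedEM.generator f g V x ≤ -w x)
    (μ : ℝ) (hμ : 0 < μ) (hwV : ∀ x, μ * V x ≤ w x)
    -- the data of the scheme
    (φ : ℝ → ℝ) (hφ : VTruncatedEM.IsGrowthFunction δ f g V w φ)
    (θ : ℝ) (hθ0 : 0 < θ) (hθ : θ < 1 / 2) (K : ℝ) (hK : 0 < K)
    (Δstar : ℝ) (hΔ0 : 0 < Δstar) (hΔ1 : Δstar < 1)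
    (hKΔ : φ (max ‖x₀‖ 1) ≤ K * Δstar ^ (-θ))
    (ϱ : ℝ) (hϱ0 : 0 < ϱ) (hϱμ : ϱ < μ) :
    ∃ Δ₂ : ℝ, 0 < Δ₂ ∧ Δ₂ ≤ Δstar ∧ ∀ Δ : ℝ, 0 < Δ → Δ ≤ Δ₂ →
      (limsup (fun k : ℕ =>
          ENNReal.log (∫⁻ ω, ENNReal.ofReal
            (V (VTruncatedEM.numSol f g φ K θ x₀ B Δ k ω)) ∂P) / (((k : ℝ) * Δ : ℝ) : EReal))
          atTop ≤ ((-(μ - ϱ) : ℝ) : EReal)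
        ∧ -(μ - ϱ) < 0)
      ∧ ∀ᵐ ω ∂P, limsup (fun k : ℕ =>
          ENNReal.log (ENNReal.ofReal
            (V (VTruncatedEM.numSol f g φ K θ x₀ B Δ k ω))) / (((k : ℝ) * Δ : ℝ) : EReal))
          atTop ≤ ((-(μ - ϱ) : ℝ) : EReal) := by
  obtain ⟨q, hq, hδq⟩ := hδ
  obtain ⟨hfc, hgc⟩ := hfg.continuous
  have hVc := hV.contDiff.continuous
  obtain ⟨C, hC0, hC⟩ := hV.exists_one_step_le m hq hδq hK hθ
  obtain ⟨Δ₂, hΔ₂0, hΔ₂, hsmall⟩ := VTruncatedEM.exists_step_size hC0 hϱ0 hθ hΔ0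
  refine ⟨Δ₂, hΔ₂0, hΔ₂, fun Δ h0 hle => ?_⟩
  -- As `-θ < 0`, the condition at `Δstar` persists for smaller `Δ`. Hence the radius is at least
  -- `‖x₀‖`, so the untruncated start lies in the ball, and at least `1`, as the growth bound
  -- requires.
  obtain ⟨hR, hφR⟩ := hφ.truncationRadius_spec (K := K) (θ := θ) (Δ := Δ)
    (u := max ‖x₀‖ 1) (by positivity) (hKΔ.trans (mul_le_mul_of_nonneg_left
      (Real.rpow_le_rpow_of_nonpos h0 (hle.trans hΔ₂) (by linarith)) hK.le))
  obtain ⟨hx₀R, hR1⟩ := max_le_iff.1 hR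
  have hR0 : 0 < VTruncatedEM.truncationRadius φ K θ Δ := by linarith
  have hball : ∀ (k : ℕ) (ω : Ω), VTruncatedEM.numSol f g φ K θ x₀ B Δ k ω
      ∈ {z : VTruncatedEM.Vec d | ‖z‖ ≤ VTruncatedEM.truncationRadius φ K θ Δ} := by
    rintro (_ | k) ω
    · exact hx₀R
    · exact VTruncatedEM.norm_radialTruncation_le hR0.le _
  have hW : Measurable fun z => ENNReal.ofReal (V z) := hVc.measurable.ennreal_ofReal
  have hΦ := VTruncatedEM.measurable_schemeStep hfc hgc
    (VTruncatedEM.truncationRadius φ K θ Δ) Δ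
  have hdecay := VTruncatedEM.lintegral_recursion_le hΦ (hB.measurable_increment Δ)
    (hB.iIndepFun_increment h0.le) (hB.map_increment h0.le)
    (Z := VTruncatedEM.numSol f g φ K θ x₀ B Δ) (x₀ := x₀) (fun _ => rfl) (fun _ _ => rfl) hW hball
    (ρ := ENNReal.ofReal (Real.exp (-(μ - ϱ / 2) * Δ))) fun z hz => by
      obtain ⟨hfz, hgz⟩ := hφ.coeff_bounds hf0 hg0 hV.nonneg hV.ker_eq hμ hwV hR1 hz
      rw [hφR] at hfz hgz
      exact VTruncatedEM.lintegral_schemeStep_le hVc hVmono hR0 h0 (hV.nonneg z)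
        ((hLV z).trans (neg_le_neg (hwV z))) (hsmall Δ h0 hle)
        (hC Δ h0 (by linarith) z (f z) (g z) hfz hgz)
  have hY : ∀ k : ℕ, Measurable fun ω =>
      ENNReal.ofReal (V (VTruncatedEM.numSol f g φ K θ x₀ B Δ k ω)) := fun k =>
    hW.comp (VTruncatedEM.indepFun_recursion hΦ (hB.measurable_increment Δ)
      (hB.iIndepFun_increment h0.le) (fun _ => rfl) (fun _ _ => rfl) k).1
  -- The gap between `-(μ - ϱ/2)` and `-(μ - ϱ)` is the remaining half of `ϱ`.
  obtain ⟨hmean, hpath⟩ := VTruncatedEM.limsup_log_le_of_lintegral_le hY (r := -(μ - ϱ)) h0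
    (by linarith) ENNReal.ofReal_ne_top hdecay
  exact ⟨⟨hmean, by linarith⟩, hpath⟩
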